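/- Let $K$ be a field. Conventions: graded vector spaces are $\mathbb Z$-graded. A graded Lie algebra has a bilinear bracket $(\cdot,\cdot)$ of degree $0$ satisfying, for homogeneous elements, $(x,y)=-(-1)^{|x||y|}(y,x)$ and $(x,(y,z))=((x,y),z)+(-1)^{|x||y|}(y,(x,z))$ (algebras over the Lie operad; in characteristic $2$ and $3$ no further identities are imposed). A dg Lie algebra $(\mathfrak h,(\cdot,\cdot),D)$ is a graded Lie algebra with a derivation $D$ of degree $+1$, $D(x,y)=(Dx,y)+(-1)^{|x|}(x,Dy)$, with $D^2=0$. An odd Leibniz algebra is a graded vector space with a bilinear bracket of degree $+1$ satisfying $[x,[y,z]]=(-1)^{|x|+1}[[x,y],z]+(-1)^{(|x|+1)(|y|+1)}[y,[x,z]]$. A Lie-Leibniz algebra is a graded Lie algebra with an odd Leibniz bracket such that $[x,(y,z)]=([x,y],z)+(-1)^{(|x|+1)|y|}(y,[x,z])$ and $[(x,y),z]=\big([x,y]-(-1)^{|x||y|}[y,x],\,z\big)$. Morphisms are linear maps of degree $0$ preserving all the structure. The derived bracket functor $\mathcal{DC}$ sends a dg Lie algebra $(\mathfrak h,(\cdot,\cdot),D)$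 to the odd Leibniz algebra $\mathfrak h$ with bracket $[x,y]:=(Dx,y)$. A Leibniz algebra is a vector space $\mathfrak g$ over $K$ with a bilinear bracket such that $[x,[y,z]]=[[x,y],z]+[y,[x,z]]$; $\mathfrak g[1]$ is $\mathfrak g$ placed in degree $-1$, an odd Leibniz algebra. Let $I\subseteq\mathfrak g$ be the span of all $[x,y]+[y,x]$, let $\mathfrak g_{Lie}=\mathfrak g/I$ and $\bar x$ the class of $x$. Let $F_{Lie}\mathfrak g[1]$ be the free graded Lie algebra on $\mathfrak g[1]$; brackets of $n$ generators have degree $-n$. Write $\{x_1,\dots,x_n\}=(x_1,(x_2,(\dots,x_n)))$. **Theorem.** For every Leibniz algebra $\mathfrak g$ the graded space $\mathcal{DR}\mathfrak g[1]:=\mathfrak g_{Lie}\oplus F_{Lie}\mathfrak g[1]$ (with $\mathfrak g_{Lie}$ in degree $0$) carries a dg Lie algebra structure $((\cdot,\cdot),\partial)$ such that: 1. $(\bar x,\bar y)=\overline{[x,y]}$ and $(\bar x,y)=[x,y]\in\mathfrak g[1]$ for $x,y\in\mathfrak g$, and on $F_{Lie}\mathfrak g[1]$ the bracket is the free Lie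 bracket. 2. $\partial=0$ on $\mathfrak g_{Lie}$, $\partial x=\bar x$ for $x\in\mathfrak g[1]$, and for $n\ge 1$ and $x_1,\dots,x_{n+1}\in\mathfrak g[1]$ $$\partial\{x_1,\dots,x_{n+1}\}=\sum_{1\le i<j\le n+1}(-1)^{i-1}\{x_1,\dots,x_i^{\vee},\dots,[x_i,x_j],x_{j+1},\dots,x_{n+1}\}+(-1)^{n-1}\{x_1,\dots,x_{n-1},[x_{n+1},x_n]\},$$ where $x_i^\vee$ means that $x_i$ is omitted and $[x_i,x_j]$ stands in the place of $x_j$. 3. There is a Leibniz bracket on $F_{Lie}\mathfrak g[1]$ that makes it, with its free Lie bracket, a Lie-Leibniz algebra and extends the bracket of $\mathfrak g[1]$; every such bracket is the derived bracket, $[\alpha,\beta]=(\partial\alpha,\beta)$ for all $\alpha,\beta\in F_{Lie}\mathfrak g[1]$. 4. The inclusion $\iota_{\mathfrak g}:\mathfrak g[1]\to\mathcal{DR}\mathfrak g[1]$, $x\mapsto 0\oplus x$, is injective and is a morphism of odd Leibniz algebras $\mathfrak g[1]\to\mathcal{DC}(\mathcal{DR}\mathfrak g[1])$. It is universal: for every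 dg Lie algebra $\mathfrak h$ and every morphism of odd Leibniz algebras $f:\mathfrak g[1]\to\mathcal{DC}\,\mathfrak h$ there is a unique morphism of dg Lie algebras $\psi:\mathcal{DR}\mathfrak g[1]\to\mathfrak h$ with $f=\psi\circ\iota_{\mathfrak g}$. 5. The assignment $\mathfrak g\mapsto\mathcal{DR}\mathfrak g[1]$ extends to a functor from Leibniz algebras to dg Lie algebras, and $\psi\mapsto\psi\circ\iota_{\mathfrak g}$ is a bijection $$\mathrm{Hom}_{dgLie}(\mathcal{DR}\mathfrak g[1],\mathfrak h)\cong\mathrm{Hom}_{Leib}(\mathfrak g[1],\mathcal{DC}\,\mathfrak h),$$ natural in $\mathfrak g$ and in $\mathfrak h$. -/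

import Mathlib

open CategoryTheory

universe u v w w'

noncomputable section

namespace DerivedBracket

/-! ## Graded algebraic structures

All gradings are by `ℤ` and homogeneous pieces are submodules of the total space.
`n.negOnePow` is the sign `(-1)^n`. -/

/-- Graded Lie algebras with bracket of degree `0` (algebras over the operad generated by one
antisymmetric operation subject to the Jacobi identity). -/
structure IsGradedLie {K : Type u} [Field K] {L : Type v} [AddCommGroup L] [Module K L]
    (deg : ℤ → Submodule K L) (br : L →ₗ[K] L →ₗ[K] L) : Prop where
  internal : DirectSum.IsInternal deg
  br_mem : ∀ {i j : ℤ} {x y : L}, x ∈ deg i → y ∈ deg j → br x y ∈ deg (i + j)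
  antisymm : ∀ {i j : ℤ} {x y : L}, x ∈ deg i → y ∈ deg j →
    br x y = -((i * j).negOnePow • br y x)
  jacobi : ∀ {i j k : ℤ} {x y z : L}, x ∈ deg i → y ∈ deg j → z ∈ deg k →
    br x (br y z) = br (br x y) z + (i * j).negOnePow • br y (br x z)

/-- Differential graded Lie algebras: the differential is a derivation of degree `+1` and squares
to zero. -/
structure IsDGLie {K : Type u} [Field K] {L : Type v} [AddCommGroup L] [Module K L]
    (deg : ℤ → Submodule K L) (br : L →ₗ[K] L →ₗ[K] L) (d : L →ₗ[K] L) : Prop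
    extends IsGradedLie deg br where
  d_mem : ∀ {i : ℤ} {x : L}, x ∈ deg i → d x ∈ deg (i + 1)
  d_br : ∀ {i : ℤ} {x : L} (y : L), x ∈ deg i →
    d (br x y) = br (d x) y + i.negOnePow • br x (d y)
  d_d : ∀ x : L, d (d x) = 0

/-- Odd (left) Leibniz algebras: the bracket has degree `+1`. If everything sits in degree `-1`,
the identity is the usual left Leibniz identity `[x,[y,z]] = [[x,y],z] + [y,[x,z]]`. -/
structure IsOddLeibniz {K : Type u} [Field K] {L : Type v} [AddCommGroup L] [Module K L]
    (deg : ℤ → Submodule K L) (b : L →ₗ[K] L →ₗ[K] L) : Prop where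
  internal : DirectSum.IsInternal deg
  b_mem : ∀ {i j : ℤ} {x y : L}, x ∈ deg i → y ∈ deg j → b x y ∈ deg (i + j + 1)
  leibniz : ∀ {i j k : ℤ} {x y z : L}, x ∈ deg i → y ∈ deg j → z ∈ deg k →
    b x (b y z) = (i + 1).negOnePow • b (b x y) z
      + ((i + 1) * (j + 1)).negOnePow • b y (b x z)

/-- Lie-Leibniz algebras: an even Lie bracket `br` and an odd Leibniz bracket `b` such that
`[x,(y,z)] = ([x,y],z) ± (y,[x,z])` and `[(x,y),z] = ([x,y] ∓ [y,x], z)` with Koszul signs. -/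
structure IsLieLeibniz {K : Type u} [Field K] {L : Type v} [AddCommGroup L] [Module K L]
    (deg : ℤ → Submodule K L) (br b : L →ₗ[K] L →ₗ[K] L) : Prop
    extends IsGradedLie deg br, IsOddLeibniz deg b where
  b_br : ∀ {i j k : ℤ} {x y z : L}, x ∈ deg i → y ∈ deg j → z ∈ deg k →
    b x (br y z) = br (b x y) z + ((i + 1) * j).negOnePow • br y (b x z)
  br_b : ∀ {i j k : ℤ} {x y z : L}, x ∈ deg i → y ∈ deg j → z ∈ deg k →
    b (br x y) z = br (b x y - (i * j).negOnePow • b y x) z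

/-! ## The categories -/

/-- A dg Lie algebra structure on a given graded space. -/
structure DGLieStr {K : Type u} [Field K] {L : Type v} [AddCommGroup L] [Module K L]
    (deg : ℤ → Submodule K L) where
  br : L →ₗ[K] L →ₗ[K] L
  d : L →ₗ[K] L
  isDGLie : IsDGLie deg br d

/-- Bundled dg Lie algebras. -/
structure DGLieAlg (K : Type u) [Field K] where
  carrier : Type v
  [addCommGroup : AddCommGroup carrier]
  [module : Module K carrier]
  deg : ℤ → Submodule K carrier
  str : DGLieStr deg

attribute [instance] DGLieAlg.addCommGroup DGLieAlg.module

/-- Bundled odd Leibniz algebras. -/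
structure OddLeibnizAlg (K : Type u) [Field K] where
  carrier : Type v
  [addCommGroup : AddCommGroup carrier]
  [module : Module K carrier]
  deg : ℤ → Submodule K carrier
  br : carrier →ₗ[K] carrier →ₗ[K] carrier
  isOddLeibniz : IsOddLeibniz deg br

attribute [instance] OddLeibnizAlg.addCommGroup OddLeibnizAlg.module

/-- Bundled (ungraded, left) Leibniz algebras. -/
structure LeibnizAlg (K : Type u) [Field K] where
  carrier : Type v
  [addCommGroup : AddCommGroup carrier]
  [module : Module K carrier]
  br : carrier →ₗ[K] carrier →ₗ[K] carrier
  leibniz : ∀ x y z : carrier, br x (br y z) = br (br x y) z + br y (br x z)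

attribute [instance] LeibnizAlg.addCommGroup LeibnizAlg.module

/-- Morphisms of dg Lie algebras. -/
@[ext]
structure DGLieHom {K : Type u} [Field K] (A : DGLieAlg.{u, v} K) (B : DGLieAlg.{u, w} K) where
  toLin : A.carrier →ₗ[K] B.carrier
  map_deg : ∀ {i : ℤ} {x : A.carrier}, x ∈ A.deg i → toLin x ∈ B.deg i
  map_br : ∀ x y : A.carrier, toLin (A.str.br x y) = B.str.br (toLin x) (toLin y)
  map_d : ∀ x : A.carrier, toLin (A.str.d x) = B.str.d (toLin x)

/-- Morphisms of odd Leibniz algebras. -/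
@[ext]
structure OddLeibnizHom {K : Type u} [Field K] (A : OddLeibnizAlg.{u, v} K)
    (B : OddLeibnizAlg.{u, w} K) where
  toLin : A.carrier →ₗ[K] B.carrier
  map_deg : ∀ {i : ℤ} {x : A.carrier}, x ∈ A.deg i → toLin x ∈ B.deg i
  map_br : ∀ x y : A.carrier, toLin (A.br x y) = B.br (toLin x) (toLin y)

/-- Morphisms of Leibniz algebras. -/
@[ext]
structure LeibnizHom {K : Type u} [Field K] (A : LeibnizAlg.{u, v} K)
    (B : LeibnizAlg.{u, w} K) where
  toLin : A.carrier →ₗ[K] B.carrier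
  map_br : ∀ x y : A.carrier, toLin (A.br x y) = B.br (toLin x) (toLin y)

/-- Composition (in diagrammatic order) of morphisms of odd Leibniz algebras. -/
def OddLeibnizHom.comp {K : Type u} [Field K] {A : OddLeibnizAlg.{u, v} K}
    {B : OddLeibnizAlg.{u, w} K} {C : OddLeibnizAlg.{u, w'} K}
    (f : OddLeibnizHom A B) (g : OddLeibnizHom B C) : OddLeibnizHom A C where
  toLin := g.toLin ∘ₗ f.toLin
  map_deg hx := g.map_deg (f.map_deg hx)
  map_br x y := by simp [f.map_br, g.map_br]

instance (K : Type u) [Field K] : Category (DGLieAlg.{u, v} K) where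
  Hom A B := DGLieHom A B
  id A := { toLin := LinearMap.id
            map_deg := fun hx => hx
            map_br := fun _ _ => rfl
            map_d := fun _ => rfl }
  comp f g := { toLin := g.toLin ∘ₗ f.toLin
                map_deg := fun hx => g.map_deg (f.map_deg hx)
                map_br := fun x y => by simp [f.map_br, g.map_br]
                map_d := fun x => by simp [f.map_d, g.map_d] }

instance (K : Type u) [Field K] : Category (OddLeibnizAlg.{u, v} K) where
  Hom A B := OddLeibnizHom A B
  id A := { toLin := LinearMap.id
            map_deg := fun hx => hx
            map_br := fun _ _ => rfl }
  comp f g := OddLeibnizHom.comp f g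

instance (K : Type u) [Field K] : Category (LeibnizAlg.{u, v} K) where
  Hom A B := LeibnizHom A B
  id A := { toLin := LinearMap.id
            map_br := fun _ _ => rfl }
  comp f g := { toLin := g.toLin ∘ₗ f.toLin
                map_br := fun x y => by simp [f.map_br, g.map_br] }

/-! ## The derived bracket construction `𝒟𝒞` -/

/-- The derived bracket `[x, y] = (d x, y)`. -/
def DGLieStr.derived {K : Type u} [Field K] {L : Type v} [AddCommGroup L] [Module K L]
    {deg : ℤ → Submodule K L} (S : DGLieStr deg) : L →ₗ[K] L →ₗ[K] L :=
  S.br ∘ₗ S.d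

theorem DGLieStr.isOddLeibniz_derived {K : Type u} [Field K] {L : Type v} [AddCommGroup L]
    [Module K L] {deg : ℤ → Submodule K L} (S : DGLieStr deg) :
    IsOddLeibniz deg S.derived where
  internal := S.isDGLie.internal
  b_mem {i j x y} hx hy := by
    have h := S.isDGLie.br_mem (S.isDGLie.d_mem hx) hy
    rwa [add_right_comm] at h
  leibniz {i j k x y z} hx hy hz := by
    have h1 := S.isDGLie.jacobi (S.isDGLie.d_mem hx) (S.isDGLie.d_mem hy) hz
    have h2 := S.isDGLie.d_br y (S.isDGLie.d_mem hx)
    rw [S.isDGLie.d_d, map_zero, LinearMap.zero_apply, zero_add] at h2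
    have h3 : S.br (S.d (S.br (S.d x) y)) z
        = (i + 1).negOnePow • S.br (S.br (S.d x) (S.d y)) z := by
      rw [h2, Units.smul_def, Units.smul_def, map_zsmul, LinearMap.smul_apply]
    simp only [DGLieStr.derived, LinearMap.comp_apply]
    rw [h3, smul_smul, Int.units_mul_self, one_smul, h1]

/-- The derived bracket construction on objects. -/
abbrev derivedObj {K : Type u} [Field K] (h : DGLieAlg.{u, v} K) : OddLeibnizAlg.{u, v} K where
  carrier := h.carrier
  deg := h.deg
  br := h.str.derived
  isOddLeibniz := h.str.isOddLeibniz_derived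

/-- The derived bracket construction on morphisms. -/
def derivedMap {K : Type u} [Field K] {A : DGLieAlg.{u, v} K} {B : DGLieAlg.{u, w} K}
    (f : DGLieHom A B) : OddLeibnizHom (derivedObj A) (derivedObj B) where
  toLin := f.toLin
  map_deg hx := f.map_deg hx
  map_br x y := (f.map_br (A.str.d x) y).trans
    (congrArg (fun z => B.str.br z (f.toLin y)) (f.map_d x))

/-- The derived bracket functor from dg Lie algebras to odd Leibniz algebras. -/
def DC (K : Type u) [Field K] : DGLieAlg.{u, v} K ⥤ OddLeibnizAlg.{u, v} K where
  obj h := derivedObj h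
  map f := derivedMap f

/-! ## The shift `𝔤[1]` -/

/-- The grading in which everything has degree `n`. -/
def concentrated (K : Type u) [Field K] (V : Type v) [AddCommGroup V] [Module K V] (n i : ℤ) :
    Submodule K V :=
  if i = n then ⊤ else ⊥

theorem concentrated_internal (K : Type u) [Field K] (V : Type v) [AddCommGroup V] [Module K V]
    (n : ℤ) : DirectSum.IsInternal (concentrated K V n) := by
  apply DirectSum.isInternal_submodule_of_iSupIndep_of_iSup_eq_top
  · intro i
    by_cases hi : i = n
    · have : (⨆ j, ⨆ (_ : j ≠ i), concentrated K V n j) = ⊥ := by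
        simp only [iSup_eq_bot]
        intro j hj
        simp [concentrated, hi ▸ hj]
      rw [this]
      exact disjoint_bot_right
    · simp [concentrated, hi]
  · rw [eq_top_iff]
    refine le_trans ?_ (le_iSup _ n)
    simp [concentrated]

theorem mem_concentrated {K : Type u} [Field K] {V : Type v} [AddCommGroup V] [Module K V]
    {n i : ℤ} {x : V} : x ∈ concentrated K V n i ↔ i = n ∨ x = 0 := by
  unfold concentrated
  split_ifs with h <;> simp [h]

/-- `𝔤[1]`: the Leibniz algebra `𝔤` placed in degree `-1`, an odd Leibniz algebra. -/
abbrev shiftObj {K : Type u} [Field K] (g : LeibnizAlg.{u, v} K) : OddLeibnizAlg.{u, v} K where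
  carrier := g.carrier
  deg := concentrated K g.carrier (-1)
  br := g.br
  isOddLeibniz :=
    { internal := concentrated_internal K g.carrier (-1)
      b_mem := by
        intro i j x y hx hy
        rw [mem_concentrated] at *
        rcases hx with rfl | rfl
        · rcases hy with rfl | rfl
          · simp
          · simp
        · simp
      leibniz := by
        intro i j k x y z hx hy _
        rw [mem_concentrated] at hx hy
        rcases hx with rfl | rfl
        · rcases hy with rfl | rfl
          · simpa using g.leibniz x y z
          · simp
        · simp }

/-- The functor `𝔤 ↦ 𝔤[1]`. -/
def shift (K : Type u) [Field K] : LeibnizAlg.{u, v} K ⥤ OddLeibnizAlg.{u, v} K where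
  obj g := shiftObj g
  map {g g'} f :=
    { toLin := f.toLin
      map_deg := fun {i x} hx => mem_concentrated.2 <|
        (mem_concentrated.1 hx).imp id fun h0 => by
          subst h0
          exact map_zero f.toLin
      map_br := fun x y => f.map_br x y }

/-! ## The Liezation `𝔤_Lie` -/

/-- The space `I` spanned by the symmetric brackets `[x,y] + [y,x]`. -/
def symmIdeal {K : Type u} [Field K] (g : LeibnizAlg.{u, v} K) : Submodule K g.carrier :=
  Submodule.span K {z | ∃ x y : g.carrier, z = g.br x y + g.br y x}

/-- The space `𝔤_Lie = 𝔤 / I`. -/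
abbrev Liezation {K : Type u} [Field K] (g : LeibnizAlg.{u, v} K) : Type v :=
  g.carrier ⧸ symmIdeal g

/-- The projection `p : 𝔤 → 𝔤_Lie`. -/
def liezationProj {K : Type u} [Field K] (g : LeibnizAlg.{u, v} K) :
    g.carrier →ₗ[K] Liezation g :=
  (symmIdeal g).mkQ

/-! ## The free graded Lie algebra on `V[1]` -/

/-- A bracket monomial in the free nonassociative algebra on the set `V`. -/
def mono (K : Type u) [Field K] {V : Type v} (m : FreeMagma V) :
    FreeNonUnitalNonAssocAlgebra K V :=
  MonoidAlgebra.single m 1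

/-- The relators defining the free graded Lie algebra on the vector space `V`, placed in
degree `-1`: linearity in the generators, graded antisymmetry, graded Jacobi identity, and
everything these generate under multiplication. A monomial with `n` letters has degree `-n`. -/
inductive IsRelator (K : Type u) [Field K] (V : Type v) [AddCommGroup V] [Module K V] :
    FreeNonUnitalNonAssocAlgebra K V → Prop
  | add (x y : V) : IsRelator K V
      (mono K (FreeMagma.of (x + y)) - mono K (FreeMagma.of x) - mono K (FreeMagma.of y))
  | smul (c : K) (x : V) : IsRelator K V
      (mono K (FreeMagma.of (c • x)) - c • mono K (FreeMagma.of x))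
  | antisymm (a b : FreeMagma V) : IsRelator K V
      (mono K a * mono K b + (-1 : K) ^ (a.length * b.length) • (mono K b * mono K a))
  | jacobi (a b c : FreeMagma V) : IsRelator K V
      (mono K a * (mono K b * mono K c) - (mono K a * mono K b) * mono K c
        - (-1 : K) ^ (a.length * b.length) • (mono K b * (mono K a * mono K c)))
  | mul_left (p r : FreeNonUnitalNonAssocAlgebra K V) : IsRelator K V r → IsRelator K V (p * r)
  | mul_right (p r : FreeNonUnitalNonAssocAlgebra K V) : IsRelator K V r → IsRelator K V (r * p)

/-- The two-sided ideal generated by the relators. -/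
def relatorIdeal (K : Type u) [Field K] (V : Type v) [AddCommGroup V] [Module K V] :
    Submodule K (FreeNonUnitalNonAssocAlgebra K V) :=
  Submodule.span K {r | IsRelator K V r}

/-- The free graded Lie algebra `F_Lie V[1]`. -/
abbrev FreeLie (K : Type u) [Field K] (V : Type v) [AddCommGroup V] [Module K V] :
    Type (max u v) :=
  FreeNonUnitalNonAssocAlgebra K V ⧸ relatorIdeal K V

/-- The class of a bracket monomial. -/
def freeMono (K : Type u) [Field K] {V : Type v} [AddCommGroup V] [Module K V]
    (m : FreeMagma V) : FreeLie K V :=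
  (relatorIdeal K V).mkQ (mono K m)

/-- The inclusion of generators `V[1] → F_Lie V[1]`. -/
def freeOf (K : Type u) [Field K] {V : Type v} [AddCommGroup V] [Module K V] (x : V) :
    FreeLie K V :=
  freeMono K (FreeMagma.of x)

theorem mul_mem_relatorIdeal_left {K : Type u} [Field K] {V : Type v} [AddCommGroup V]
    [Module K V] (p : FreeNonUnitalNonAssocAlgebra K V)
    {r : FreeNonUnitalNonAssocAlgebra K V} (hr : r ∈ relatorIdeal K V) :
    p * r ∈ relatorIdeal K V := by
  have h : relatorIdeal K V ≤ (relatorIdeal K V).comap (LinearMap.mulLeft K p) :=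
    Submodule.span_le.2 fun r hr => Submodule.subset_span (IsRelator.mul_left p r hr)
  exact h hr

theorem mul_mem_relatorIdeal_right {K : Type u} [Field K] {V : Type v} [AddCommGroup V]
    [Module K V] (p : FreeNonUnitalNonAssocAlgebra K V)
    {r : FreeNonUnitalNonAssocAlgebra K V} (hr : r ∈ relatorIdeal K V) :
    r * p ∈ relatorIdeal K V := by
  have h : relatorIdeal K V ≤ (relatorIdeal K V).comap (LinearMap.mulRight K p) :=
    Submodule.span_le.2 fun r hr => Submodule.subset_span (IsRelator.mul_right p r hr)
  exact h hr

/-- The bracket of the free graded Lie algebra, induced by the product of monomials. -/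
def freeBr (K : Type u) [Field K] (V : Type v) [AddCommGroup V] [Module K V] :
    FreeLie K V →ₗ[K] FreeLie K V →ₗ[K] FreeLie K V :=
  LinearMap.liftQ₂ (relatorIdeal K V) (relatorIdeal K V)
    ((LinearMap.mul K (FreeNonUnitalNonAssocAlgebra K V)).compr₂ (relatorIdeal K V).mkQ)
    (fun r hr => LinearMap.ext fun p => by
      simpa using mul_mem_relatorIdeal_right p hr)
    (fun r hr => LinearMap.ext fun p => by
      simpa using mul_mem_relatorIdeal_left p hr)

/-- The grading of the free graded Lie algebra: brackets of `n` generators have degree `-n`. -/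
def freeDeg (K : Type u) [Field K] (V : Type v) [AddCommGroup V] [Module K V] (i : ℤ) :
    Submodule K (FreeLie K V) :=
  Submodule.span K {α | ∃ m : FreeMagma V, (m.length : ℤ) = -i ∧ α = freeMono K m}

/-- The right normalized bracket `{x₁,…,xₙ₊₁} = (x₁,(x₂,(…,xₙ₊₁)))`. -/
def rightNormed (K : Type u) [Field K] {V : Type v} [AddCommGroup V] [Module K V] :
    {n : ℕ} → (Fin (n + 1) → V) → FreeLie K V
  | 0, x => freeOf K (x 0)
  | _ + 1, x => freeBr K V (freeOf K (x 0)) (rightNormed K (Fin.tail x))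

/-- The value of the differential `∂` on `{x₁,…,xₙ₊₁}`, where `n = m + 1 ≥ 1`:
`∑_{i<j} (-1)^(i-1) {x₁,…,xᵢ omitted,…,[xᵢ,xⱼ],xⱼ₊₁,…,xₙ₊₁}
  + (-1)^(n-1) {x₁,…,xₙ₋₁,[xₙ₊₁,xₙ]}`.
In the code the indices start at `0`. -/
def boundary {K : Type u} [Field K] (g : LeibnizAlg.{u, v} K) {m : ℕ}
    (x : Fin (m + 2) → g.carrier) : FreeLie K g.carrier :=
  (∑ p : Fin (m + 2) × Fin (m + 2) with p.1 < p.2,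
    (-1 : K) ^ (p.1 : ℕ) •
      rightNormed K (p.1.removeNth (Function.update x p.2 (g.br (x p.1) (x p.2)))))
  + (-1 : K) ^ m •
      rightNormed K (Function.update (Fin.init x) (Fin.last m)
        (g.br (x (Fin.last (m + 1))) (x (Fin.last m).castSucc)))

/-! ## The total space `𝔤_Lie ⊕ F_Lie 𝔤[1]` -/

/-- The underlying vector space `𝔤_Lie ⊕ F_Lie 𝔤[1]`. -/
abbrev Total {K : Type u} [Field K] (g : LeibnizAlg.{u, v} K) : Type (max u v) :=
  Liezation g × FreeLie K g.carrier

/-- Its grading: `𝔤_Lie` in degree `0` and brackets of `n` elements of `𝔤[1]` in degree `-n`. -/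
def totalDeg {K : Type u} [Field K] (g : LeibnizAlg.{u, v} K) (i : ℤ) :
    Submodule K (Total g) :=
  (concentrated K (Liezation g) 0 i).prod (freeDeg K g.carrier i)

/-- The dg Lie algebra given by a dg Lie structure on the total space. -/
abbrev totalObj {K : Type u} [Field K] {g : LeibnizAlg.{u, v} K} (S : DGLieStr (totalDeg g)) :
    DGLieAlg.{u, max u v} K where
  carrier := Total g
  deg := totalDeg g
  str := S

end DerivedBracket

end

open DerivedBracket

noncomputable section

namespace DerivedBracket

/-! ## Basic facts on the free graded Lie algebra -/

section FreeAlgebra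

variable {K : Type u} [Field K] {V : Type v}

/-! Left multiplication by `x` on a Leibniz algebra is a derivation, so it extends to a derivation
of degree 0 of the free graded Lie algebra on `𝔤[1]`. By the Leibniz identity the operator of
`[x,y]` is the commutator of the operators of `x` and `y`. Hence the symmetric brackets act by zero,
`𝔤_Lie` acts, and the semidirect product `𝔤_Lie ⊕ F_Lie 𝔤[1]` is a graded Lie algebra
(`total_isGradedLie`).

The assignment `x ↦ x̄` extends uniquely to a derivation of degree 1 along the inclusion of the free
summand. It commutes with the action of `𝔤_Lie` (`freeDifferential_lieAct`), so extending it by zero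
on `𝔤_Lie` gives a derivation of the whole algebra (`totalDifferential_br`). Its square vanishes
because it vanishes on generators. The formula on right normalized brackets is the derivation rule
unrolled (`boundary_succ`, `freeDifferential_rightNormed`).

The free summand is an ideal, so the derived bracket restricts to it, and the Lie-Leibniz axioms are
the Jacobi identity and the derivation rule of the total algebra (`freeLeibniz_isLieLeibniz`). These
axioms also reduce any such bracket to generators (`lieLeibniz_unique`).

For universality, `x̄ = ∂x` shows that `𝔤[1]` generates the dg Lie algebra, hence uniqueness
(`totalHom_ext`). Existence takes the free extension of `f` on one summand and `x̄ ↦ d (f x)` on the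
other (`exists_totalLift`). Functoriality and the natural bijection are formal consequences.

The technical tool is `exists_derivation`: a derivation along a homomorphism is one component of a
homomorphism into a larger algebra with graded Lie identities, so freeness provides it. All signs
are handled without dividing, so every characteristic is allowed. -/

theorem mono_mul_mono (a b : FreeMagma V) : mono K a * mono K b = mono K (a * b) := by
  simp [mono]

theorem span_mono : Submodule.span K (Set.range fun m : FreeMagma V => mono K m) = ⊤ :=
  (MonoidAlgebra.basis (FreeMagma V) K).span_eq

/-- Linear maps out of the free nonassociative algebra agree if they agree on monomials. -/
theorem freeAlg_hom_ext {A : Type w} [AddCommGroup A] [Module K A]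
    {f g : FreeNonUnitalNonAssocAlgebra K V →ₗ[K] A} (h : ∀ m, f (mono K m) = g (mono K m)) :
    f = g :=
  (MonoidAlgebra.basis (FreeMagma V) K).ext h

@[elab_as_elim]
theorem freeAlg_span_induction {P : FreeNonUnitalNonAssocAlgebra K V → Prop}
    (mono : ∀ m, P (mono K m)) (zero : P 0) (add : ∀ p q, P p → P q → P (p + q))
    (smul : ∀ (c : K) p, P p → P (c • p)) (p : FreeNonUnitalNonAssocAlgebra K V) : P p := by
  have hp : p ∈ Submodule.span K (Set.range fun m : FreeMagma V => DerivedBracket.mono K m) := by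
    rw [span_mono]; trivial
  induction hp using Submodule.span_induction with
  | mem x hx => obtain ⟨m, rfl⟩ := hx; exact mono m
  | zero => exact zero
  | add x y _ _ hx hy => exact add x y hx hy
  | smul c x _ hx => exact smul c x hx

/-- The projection of the free nonassociative algebra to the span of the monomials of
degree `i`. -/
def algProj (K : Type u) [Field K] (V : Type v) (i : ℤ) :
    FreeNonUnitalNonAssocAlgebra K V →ₗ[K] FreeNonUnitalNonAssocAlgebra K V :=
  (MonoidAlgebra.basis (FreeMagma V) K).constr K
    fun m => if i = -m.length then mono K m else 0

theorem algProj_mono (i : ℤ) (m : FreeMagma V) :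
    algProj K V i (mono K m) = if i = -m.length then mono K m else 0 :=
  (MonoidAlgebra.basis (FreeMagma V) K).constr_basis K _ m

/-- Taking the length up to an equation lets rearranged monomials be tested against the same
condition, so that one case split treats a whole homogeneous relator. -/
theorem algProj_of_length {m : FreeMagma V} {n : ℕ} (hm : m.length = n) (i : ℤ) :
    algProj K V i (mono K m) = if i = -n then mono K m else 0 := by
  rw [algProj_mono, hm]

theorem algProj_of (x : V) (i : ℤ) :
    algProj K V i (mono K (FreeMagma.of x)) = if i = -1 then mono K (FreeMagma.of x) else 0 :=
  algProj_of_length (n := 1) rfl i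

/-- A monomial with `n` letters lowers degrees by `n`, so the projection passes through the product
with its index shifted by `n`. -/
theorem algProj_mono_mul (i : ℤ) (m : FreeMagma V) (r : FreeNonUnitalNonAssocAlgebra K V) :
    algProj K V i (mono K m * r) = mono K m * algProj K V (i + m.length) r := by
  have h : algProj K V i ∘ₗ LinearMap.mulLeft K (mono K m)
      = LinearMap.mulLeft K (mono K m) ∘ₗ algProj K V (i + m.length) := by
    refine freeAlg_hom_ext fun n => ?_
    simp only [LinearMap.comp_apply, LinearMap.mulLeft_apply, mono_mul_mono, algProj_mono,
      FreeMagma.length, Nat.cast_add]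
    by_cases h : i = -(m.length + n.length : ℤ)
    · rw [if_pos h, if_pos (by omega), mono_mul_mono]
    · rw [if_neg h, if_neg (by omega), mul_zero]
  exact LinearMap.congr_fun h r

theorem algProj_mul_mono (i : ℤ) (m : FreeMagma V) (r : FreeNonUnitalNonAssocAlgebra K V) :
    algProj K V i (r * mono K m) = algProj K V (i + m.length) r * mono K m := by
  have h : algProj K V i ∘ₗ LinearMap.mulRight K (mono K m)
      = LinearMap.mulRight K (mono K m) ∘ₗ algProj K V (i + m.length) := by
    refine freeAlg_hom_ext fun n => ?_
    simp only [LinearMap.comp_apply, LinearMap.mulRight_apply, mono_mul_mono, algProj_mono,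
      FreeMagma.length, Nat.cast_add]
    by_cases h : i = -(n.length + m.length : ℤ)
    · rw [if_pos h, if_pos (by omega), mono_mul_mono]
    · rw [if_neg h, if_neg (by omega), zero_mul]
  exact LinearMap.congr_fun h r

end FreeAlgebra

/-! ### The free graded Lie algebra as a quotient: monomials, generators and relations -/

section FreeLieBasics

variable {K : Type u} [Field K] {V : Type v} [AddCommGroup V] [Module K V]

theorem freeBr_mkQ (p q : FreeNonUnitalNonAssocAlgebra K V) :
    freeBr K V ((relatorIdeal K V).mkQ p) ((relatorIdeal K V).mkQ q)
      = (relatorIdeal K V).mkQ (p * q) := rfl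

theorem freeBr_freeMono (a b : FreeMagma V) :
    freeBr K V (freeMono K a) (freeMono K b) = freeMono K (a * b) := by
  simp only [freeMono, freeBr_mkQ, mono_mul_mono]

theorem span_freeMono :
    Submodule.span K (Set.range fun m : FreeMagma V => freeMono K m) = ⊤ := by
  have h : (Set.range fun m : FreeMagma V => freeMono K m)
      = (relatorIdeal K V).mkQ '' (Set.range fun m : FreeMagma V => mono K m) := by
    rw [← Set.range_comp]; rfl
  rw [h, ← Submodule.map_span, span_mono, Submodule.map_top, Submodule.range_mkQ]

@[elab_as_elim]
theorem freeLie_span_induction {P : FreeLie K V → Prop} (mono : ∀ m, P (freeMono K m))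
    (zero : P 0) (add : ∀ α β, P α → P β → P (α + β)) (smul : ∀ (c : K) α, P α → P (c • α))
    (α : FreeLie K V) : P α := by
  have hα : α ∈ Submodule.span K (Set.range fun m : FreeMagma V => freeMono K m) := by
    rw [span_freeMono]; trivial
  induction hα using Submodule.span_induction with
  | mem x hx => obtain ⟨m, rfl⟩ := hx; exact mono m
  | zero => exact zero
  | add x y _ _ hx hy => exact add x y hx hy
  | smul c x _ hx => exact smul c x hx

theorem freeMono_mem (m : FreeMagma V) : freeMono K m ∈ freeDeg K V (-m.length) :=
  Submodule.subset_span ⟨m, by simp, rfl⟩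

theorem freeOf_mem (x : V) : freeOf K x ∈ freeDeg K V (-1) := by
  exact freeMono_mem (K := K) (FreeMagma.of x)

@[elab_as_elim]
theorem freeDeg_induction {i : ℤ} {P : FreeLie K V → Prop}
    (mono : ∀ m : FreeMagma V, i = -m.length → P (freeMono K m))
    (zero : P 0) (add : ∀ α β, P α → P β → P (α + β)) (smul : ∀ (c : K) α, P α → P (c • α))
    {α : FreeLie K V} (hα : α ∈ freeDeg K V i) : P α := by
  induction hα using Submodule.span_induction with
  | mem x hx => obtain ⟨m, hm, rfl⟩ := hx; exact mono m (by omega)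
  | zero => exact zero
  | add x y _ _ hx hy => exact add x y hx hy
  | smul c x _ hx => exact smul c x hx

/-- Bridges the two sign conventions: graded identities carry integer signs indexed by degrees,
while the relators carry powers of `-1` in `K` indexed by word lengths. -/
theorem negOnePow_smul_eq {A : Type w} [AddCommGroup A] [Module K A] (a b : ℕ) (x : A) :
    ((-(a : ℤ)) * (-(b : ℤ))).negOnePow • x = (-1 : K) ^ (a * b) • x := by
  rw [neg_mul_neg, ← Nat.cast_mul, Units.smul_def, Int.coe_negOnePow_natCast]
  rcases neg_one_pow_eq_or ℤ (a * b) with h | h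
  · have : Even (a * b) ∨ Odd (a * b) := Nat.even_or_odd _
    rcases this with h' | h' <;> simp [h'.neg_one_pow]
  · have : Even (a * b) ∨ Odd (a * b) := Nat.even_or_odd _
    rcases this with h' | h' <;> simp [h'.neg_one_pow]

theorem mkQ_relator {r : FreeNonUnitalNonAssocAlgebra K V} (h : IsRelator K V r) :
    (relatorIdeal K V).mkQ r = 0 := by
  rw [Submodule.mkQ_apply, Submodule.Quotient.mk_eq_zero]
  exact Submodule.subset_span h

theorem freeOf_add (x y : V) : freeOf K (x + y) = freeOf K x + freeOf K y := by
  have h := mkQ_relator (IsRelator.add (K := K) x y)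
  rw [map_sub, map_sub, sub_sub, sub_eq_zero] at h
  exact h

theorem freeOf_smul (c : K) (x : V) : freeOf K (c • x) = c • freeOf K x := by
  have h := mkQ_relator (IsRelator.smul (K := K) c x)
  rw [map_sub, map_smul, sub_eq_zero] at h
  exact h

/-- The inclusion of generators as a linear map. -/
def freeOfₗ (K : Type u) [Field K] (V : Type v) [AddCommGroup V] [Module K V] :
    V →ₗ[K] FreeLie K V where
  toFun := freeOf K
  map_add' := freeOf_add
  map_smul' := freeOf_smul

theorem freeMono_antisymm (a b : FreeMagma V) :
    freeMono K (a * b) = -((-1 : K) ^ (a.length * b.length) • freeMono K (b * a)) := by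
  have h := mkQ_relator (IsRelator.antisymm (K := K) a b)
  rw [map_add, map_smul, mono_mul_mono, mono_mul_mono] at h
  exact eq_neg_of_add_eq_zero_left h

theorem freeMono_jacobi (a b c : FreeMagma V) :
    freeMono K (a * (b * c)) = freeMono K (a * b * c)
      + (-1 : K) ^ (a.length * b.length) • freeMono K (b * (a * c)) := by
  have h := mkQ_relator (IsRelator.jacobi (K := K) a b c)
  simp only [map_sub, map_smul, mono_mul_mono] at h
  rw [sub_sub, sub_eq_zero] at h
  exact h

end FreeLieBasics

/-- The identities of a graded Lie algebra, on a family of subspaces which is not required to be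
a direct sum decomposition. -/
structure IsGradedBracket {K : Type u} [Field K] {L : Type v} [AddCommGroup L] [Module K L]
    (deg : ℤ → Submodule K L) (br : L →ₗ[K] L →ₗ[K] L) : Prop where
  br_mem : ∀ {i j : ℤ} {x y : L}, x ∈ deg i → y ∈ deg j → br x y ∈ deg (i + j)
  antisymm : ∀ {i j : ℤ} {x y : L}, x ∈ deg i → y ∈ deg j →
    br x y = -((i * j).negOnePow • br y x)
  jacobi : ∀ {i j k : ℤ} {x y z : L}, x ∈ deg i → y ∈ deg j → z ∈ deg k →
    br x (br y z) = br (br x y) z + (i * j).negOnePow • br y (br x z)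

theorem IsGradedLie.isGradedBracket {K : Type u} [Field K] {L : Type v} [AddCommGroup L]
    [Module K L] {deg : ℤ → Submodule K L} {br : L →ₗ[K] L →ₗ[K] L} (h : IsGradedLie deg br) :
    IsGradedBracket deg br :=
  ⟨h.br_mem, h.antisymm, h.jacobi⟩

/-- A family of subspaces which spans and is separated by projections is a direct sum
decomposition. -/
theorem isInternal_of_projections {K : Type u} [Field K] {L : Type v} [AddCommGroup L]
    [Module K L] {deg : ℤ → Submodule K L} (π : ℤ → L →ₗ[K] L)
    (hself : ∀ i, ∀ x ∈ deg i, π i x = x) (hne : ∀ i j, j ≠ i → ∀ x ∈ deg j, π i x = 0)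
    (htop : ⨆ i, deg i = ⊤) : DirectSum.IsInternal deg := by
  refine DirectSum.isInternal_submodule_of_iSupIndep_of_iSup_eq_top ?_ htop
  intro i
  rw [Submodule.disjoint_def]
  intro x hx hx'
  have h : (⨆ (j) (_ : j ≠ i), deg j) ≤ LinearMap.ker (π i) :=
    iSup₂_le fun j hj y hy => hne i j hj y hy
  rw [← hself i x hx]
  exact h hx'

/-! ### The grading of the free graded Lie algebra -/

section FreeLieGraded

variable {K : Type u} [Field K] {V : Type v} [AddCommGroup V] [Module K V]

theorem freeBr_mem {i j : ℤ} {α β : FreeLie K V} (hα : α ∈ freeDeg K V i)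
    (hβ : β ∈ freeDeg K V j) : freeBr K V α β ∈ freeDeg K V (i + j) := by
  refine freeDeg_induction (fun a ha => ?_) (by simp)
    (fun α α' h h' => by simpa using add_mem h h')
    (fun c α h => by simpa using Submodule.smul_mem _ c h) hα
  refine freeDeg_induction (fun b hb => ?_) (by simp)
    (fun α α' h h' => by simpa using add_mem h h')
    (fun c α h => by simpa using Submodule.smul_mem _ c h) hβ
  rw [freeBr_freeMono, ha, hb]
  have h := freeMono_mem (K := K) (a * b)
  simp only [FreeMagma.length, Nat.cast_add, neg_add] at h
  exact h

theorem freeBr_isGradedBracket : IsGradedBracket (freeDeg K V) (freeBr K V) where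
  br_mem := freeBr_mem
  antisymm {i j α β} hα hβ := by
    refine freeDeg_induction (fun a ha => ?_) (by simp) (fun α α' h h' => ?_)
      (fun c α h => ?_) hα
    · refine freeDeg_induction (fun b hb => ?_) (by simp) (fun α α' h h' => ?_)
        (fun c α h => ?_) hβ
      · rw [ha, hb, negOnePow_smul_eq (K := K), freeBr_freeMono, freeBr_freeMono,
          freeMono_antisymm]
      · simp only [map_add, LinearMap.add_apply, smul_add, h, h', neg_add]
      · simp only [map_smul, LinearMap.smul_apply, h, smul_neg, smul_comm c]
    · simp only [map_add, LinearMap.add_apply, smul_add, h, h', neg_add]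
    · simp only [map_smul, LinearMap.smul_apply, h, smul_neg, smul_comm c]
  jacobi {i j k α β γ} hα hβ hγ := by
    refine freeDeg_induction (fun a ha => ?_) (by simp) (fun α α' h h' => ?_)
      (fun c α h => ?_) hα
    · refine freeDeg_induction (fun b hb => ?_) (by simp) (fun α α' h h' => ?_)
        (fun c α h => ?_) hβ
      · refine freeDeg_induction (fun d hd => ?_) (by simp) (fun α α' h h' => ?_)
          (fun c α h => ?_) hγ
        · rw [ha, hb, negOnePow_smul_eq (K := K)]
          simp only [freeBr_freeMono]
          exact freeMono_jacobi a b d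
        · simp only [map_add, smul_add, h, h']; abel
        · simp only [map_smul, h, smul_add, smul_comm c]
      · simp only [map_add, LinearMap.add_apply, smul_add, h, h']; abel
      · simp only [map_smul, LinearMap.smul_apply, h, smul_add, smul_comm c]
    · simp only [map_add, LinearMap.add_apply, smul_add, h, h']; abel
    · simp only [map_smul, LinearMap.smul_apply, h, smul_add, smul_comm c]

/-- The basic relators are homogeneous, so each projection returns the relator or zero. Products are
reduced to multiplication by a monomial, which shifts the index; therefore the induction runs over
all `i` at once. This is why the grading descends to the quotient. -/
theorem algProj_relator {r : FreeNonUnitalNonAssocAlgebra K V} (hr : IsRelator K V r) (i : ℤ) :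
    algProj K V i r ∈ relatorIdeal K V := by
  induction hr generalizing i with
  | add x y =>
    simp only [map_sub, algProj_of]
    split_ifs
    · exact Submodule.subset_span (.add x y)
    · simp
  | smul c x =>
    simp only [map_sub, map_smul, algProj_of]
    split_ifs
    · exact Submodule.subset_span (.smul c x)
    · simp
  | antisymm a b =>
    have h := Submodule.subset_span (R := K) (IsRelator.antisymm (K := K) a b)
    simp only [mono_mul_mono] at h ⊢
    rw [map_add, map_smul, algProj_of_length (n := a.length + b.length) rfl,
      algProj_of_length (n := a.length + b.length) (add_comm _ _)]
    split_ifs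
    · exact h
    · simp
  | jacobi a b c =>
    have h := Submodule.subset_span (R := K) (IsRelator.jacobi (K := K) a b c)
    simp only [mono_mul_mono] at h ⊢
    rw [map_sub, map_sub, map_smul,
      algProj_of_length (n := a.length + (b.length + c.length)) rfl,
      algProj_of_length (n := a.length + (b.length + c.length)) (add_assoc _ _ _),
      algProj_of_length (n := a.length + (b.length + c.length)) (add_left_comm _ _ _)]
    split_ifs
    · exact h
    · simp
  | mul_left p r _ ih =>
    induction p using freeAlg_span_induction with
    | mono m => rw [algProj_mono_mul]; exact mul_mem_relatorIdeal_left _ (ih _)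
    | zero => simp
    | add p q hp hq => rw [add_mul, map_add]; exact add_mem hp hq
    | smul c p hp => rw [smul_mul_assoc, map_smul]; exact Submodule.smul_mem _ _ hp
  | mul_right p r _ ih =>
    induction p using freeAlg_span_induction with
    | mono m => rw [algProj_mul_mono]; exact mul_mem_relatorIdeal_right _ (ih _)
    | zero => simp
    | add p q hp hq => rw [mul_add, map_add]; exact add_mem hp hq
    | smul c p hp => rw [mul_smul_comm, map_smul]; exact Submodule.smul_mem _ _ hp

/-- The projection of the free graded Lie algebra to its part of degree `i`. -/
def freeProj (K : Type u) [Field K] (V : Type v) [AddCommGroup V] [Module K V] (i : ℤ) :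
    FreeLie K V →ₗ[K] FreeLie K V :=
  (relatorIdeal K V).mapQ (relatorIdeal K V) (algProj K V i)
    (Submodule.span_le.2 fun _ hr => algProj_relator hr i)

theorem freeProj_freeMono (i : ℤ) (m : FreeMagma V) :
    freeProj K V i (freeMono K m) = if i = -m.length then freeMono K m else 0 := by
  have h : freeProj K V i (freeMono K m) = (relatorIdeal K V).mkQ (algProj K V i (mono K m)) := rfl
  rw [h, algProj_mono, apply_ite (relatorIdeal K V).mkQ, map_zero, freeMono]

theorem freeProj_of_mem {i : ℤ} {α : FreeLie K V} (hα : α ∈ freeDeg K V i) :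
    freeProj K V i α = α :=
  freeDeg_induction (fun m hm => by rw [freeProj_freeMono, if_pos hm]) (map_zero _)
    (fun α β hα hβ => by rw [map_add, hα, hβ]) (fun c α hα => by rw [map_smul, hα]) hα

theorem freeProj_of_mem_ne {i j : ℤ} (hij : j ≠ i) {α : FreeLie K V} (hα : α ∈ freeDeg K V j) :
    freeProj K V i α = 0 :=
  freeDeg_induction (fun m hm => by rw [freeProj_freeMono, if_neg (by omega)]) (map_zero _)
    (fun α β hα hβ => by rw [map_add, hα, hβ, add_zero])
    (fun c α hα => by rw [map_smul, hα, smul_zero]) hα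

theorem iSup_freeDeg : ⨆ i, freeDeg K V i = ⊤ := by
  rw [eq_top_iff, ← span_freeMono, Submodule.span_le]
  rintro _ ⟨m, rfl⟩
  exact Submodule.mem_iSup_of_mem _ (freeMono_mem m)

/-- Every monomial has at least one letter, so only negative degrees occur. This keeps the free
summand apart from `𝔤_Lie`, which sits in degree 0. -/
theorem freeDeg_of_nonneg {i : ℤ} (hi : 0 ≤ i) {α : FreeLie K V} (hα : α ∈ freeDeg K V i) :
    α = 0 :=
  freeDeg_induction (fun m hm => by have := m.length_pos; omega) rfl
    (fun α β hα hβ => by rw [hα, hβ, add_zero]) (fun c α hα => by rw [hα, smul_zero]) hα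

theorem freeLie_isGradedLie : IsGradedLie (freeDeg K V) (freeBr K V) where
  internal := isInternal_of_projections (freeProj K V) (fun _ _ h => freeProj_of_mem h)
    (fun _ _ hij _ h => freeProj_of_mem_ne hij h) iSup_freeDeg
  br_mem := freeBr_isGradedBracket.br_mem
  antisymm := freeBr_isGradedBracket.antisymm
  jacobi := freeBr_isGradedBracket.jacobi

end FreeLieGraded

/-! ## The universal property of the free graded Lie algebra, and derivations -/

section Evaluation

variable {K : Type u} [Field K] {V : Type v} {A : Type w} [AddCommGroup A] [Module K A]
  {deg : ℤ → Submodule K A} {br : A →ₗ[K] A →ₗ[K] A}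

/-- Evaluation of bracket monomials. -/
def magmaEval (br : A →ₗ[K] A →ₗ[K] A) (f : V → A) : FreeMagma V → A
  | .of x => f x
  | .mul a b => br (magmaEval br f a) (magmaEval br f b)

/-- The linear extension of the evaluation of bracket monomials. -/
def algEval (br : A →ₗ[K] A →ₗ[K] A) (f : V → A) : FreeNonUnitalNonAssocAlgebra K V →ₗ[K] A :=
  (MonoidAlgebra.basis (FreeMagma V) K).constr K (magmaEval br f)

theorem algEval_mono (f : V → A) (m : FreeMagma V) :
    algEval br f (mono K m) = magmaEval br f m :=
  (MonoidAlgebra.basis (FreeMagma V) K).constr_basis K _ m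

theorem algEval_mul (f : V → A) (p q : FreeNonUnitalNonAssocAlgebra K V) :
    algEval br f (p * q) = br (algEval br f p) (algEval br f q) := by
  induction p using freeAlg_span_induction with
  | mono a =>
    induction q using freeAlg_span_induction with
    | mono b =>
      rw [mono_mul_mono, algEval_mono, algEval_mono, algEval_mono]
      rfl
    | zero => simp
    | add p q hp hq => rw [mul_add, map_add, map_add, map_add, hp, hq]
    | smul c p hp => rw [mul_smul_comm, map_smul, map_smul, map_smul, hp]
  | zero => simp
  | add p q hp hq => rw [add_mul, map_add, map_add, map_add, LinearMap.add_apply, hp, hq]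
  | smul c p hp => rw [smul_mul_assoc, map_smul, map_smul, map_smul, LinearMap.smul_apply, hp]

theorem magmaEval_mem (h : IsGradedBracket deg br) {f : V → A} (hf : ∀ x, f x ∈ deg (-1))
    (m : FreeMagma V) : magmaEval br f m ∈ deg (-m.length) := by
  induction m with
  | ih1 x => exact hf x
  | ih2 a b ha hb =>
    simp only [FreeMagma.length, Nat.cast_add, neg_add]
    exact h.br_mem ha hb

end Evaluation

/-! ### Extension of linear maps and derivations from generators -/

section Lift

variable {K : Type u} [Field K] {V : Type v} [AddCommGroup V] [Module K V]
  {A : Type w} [AddCommGroup A] [Module K A] {deg : ℤ → Submodule K A}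
  {br : A →ₗ[K] A →ₗ[K] A}

/-- Since generators go to degree -1, a monomial with `n` letters evaluates in degree `-n`. The
signs of the relators are then those of the identities in the target. -/
theorem algEval_relator (h : IsGradedBracket deg br) (f : V →ₗ[K] A)
    (hf : ∀ x, f x ∈ deg (-1)) {r : FreeNonUnitalNonAssocAlgebra K V} (hr : IsRelator K V r) :
    algEval br f r = 0 := by
  have hm := magmaEval_mem h hf
  induction hr with
  | add x y => simp [algEval_mono, magmaEval]
  | smul c x => simp [algEval_mono, magmaEval]
  | antisymm a b =>
    simp only [map_add, map_smul, algEval_mul, algEval_mono]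
    rw [h.antisymm (hm a) (hm b), negOnePow_smul_eq (K := K), neg_add_cancel]
  | jacobi a b c =>
    simp only [map_sub, map_smul, algEval_mul, algEval_mono]
    rw [h.jacobi (hm a) (hm b) (hm c), negOnePow_smul_eq (K := K)]
    abel
  | mul_left p r _ ih => rw [algEval_mul, ih, map_zero]
  | mul_right p r _ ih => rw [algEval_mul, ih, map_zero, LinearMap.zero_apply]

/-- The homomorphism from the free graded Lie algebra extending a linear map on generators. -/
theorem exists_freeLift (h : IsGradedBracket deg br) (f : V →ₗ[K] A)
    (hf : ∀ x, f x ∈ deg (-1)) :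
    ∃ φ : FreeLie K V →ₗ[K] A, (∀ x, φ (freeOf K x) = f x) ∧
      ∀ α β, φ (freeBr K V α β) = br (φ α) (φ β) := by
  refine ⟨(relatorIdeal K V).liftQ (algEval br f)
    (Submodule.span_le.2 fun r hr => algEval_relator h f hf hr), fun x => ?_, fun α β => ?_⟩
  · exact algEval_mono f (FreeMagma.of x)
  · obtain ⟨p, rfl⟩ := (relatorIdeal K V).mkQ_surjective α
    obtain ⟨q, rfl⟩ := (relatorIdeal K V).mkQ_surjective β
    exact algEval_mul f p q

/-- Induction over iterated brackets of generators. -/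
@[elab_as_elim]
theorem freeMono_induction {P : ℤ → FreeLie K V → Prop} (of : ∀ x, P (-1) (freeOf K x))
    (br : ∀ (i j : ℤ) (α β : FreeLie K V), α ∈ freeDeg K V i → β ∈ freeDeg K V j →
      P i α → P j β → P (i + j) (freeBr K V α β)) (m : FreeMagma V) :
    P (-m.length) (freeMono K m) := by
  induction m with
  | ih1 x => exact of x
  | ih2 a b ha hb =>
    have h := br _ _ _ _ (freeMono_mem a) (freeMono_mem b) ha hb
    rw [freeBr_freeMono] at h
    simpa only [FreeMagma.length, Nat.cast_add, neg_add] using h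

/-- Induction over homogeneous elements of the free graded Lie algebra. -/
@[elab_as_elim]
theorem freeLie_homogeneous_induction {P : ℤ → FreeLie K V → Prop}
    (of : ∀ x, P (-1) (freeOf K x))
    (br : ∀ (i j : ℤ) (α β : FreeLie K V), α ∈ freeDeg K V i → β ∈ freeDeg K V j →
      P i α → P j β → P (i + j) (freeBr K V α β))
    (zero : ∀ i, P i 0) (add : ∀ i α β, P i α → P i β → P i (α + β))
    (smul : ∀ i (c : K) α, P i α → P i (c • α)) {i : ℤ} {α : FreeLie K V}
    (hα : α ∈ freeDeg K V i) : P i α := by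
  refine freeDeg_induction (fun m hm => ?_) (zero i) (add i) (smul i) hα
  subst hm
  exact freeMono_induction of br m

/-- Induction over the free graded Lie algebra. -/
@[elab_as_elim]
theorem freeLie_induction {P : FreeLie K V → Prop} (of : ∀ x, P (freeOf K x))
    (br : ∀ (i j : ℤ) (α β : FreeLie K V), α ∈ freeDeg K V i → β ∈ freeDeg K V j →
      P α → P β → P (freeBr K V α β))
    (zero : P 0) (add : ∀ α β, P α → P β → P (α + β)) (smul : ∀ (c : K) α, P α → P (c • α))
    (α : FreeLie K V) : P α := by
  induction α using freeLie_span_induction with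
  | mono m => exact freeMono_induction (P := fun _ => P) of br m
  | zero => exact zero
  | add α β hα hβ => exact add α β hα hβ
  | smul c α hα => exact smul c α hα

theorem freeHom_mem (h : IsGradedBracket deg br) {φ : FreeLie K V →ₗ[K] A}
    (hφ : ∀ α β, φ (freeBr K V α β) = br (φ α) (φ β)) (hf : ∀ x, φ (freeOf K x) ∈ deg (-1))
    {i : ℤ} {α : FreeLie K V} (hα : α ∈ freeDeg K V i) : φ α ∈ deg i := by
  refine freeLie_homogeneous_induction hf (fun i j α β _ _ ih ih' => ?_) (fun i => ?_)
    (fun i α β ih ih' => ?_) (fun i c α ih => ?_) hα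
  · rw [hφ]; exact h.br_mem ih ih'
  · rw [map_zero]; exact zero_mem _
  · rw [map_add]; exact add_mem ih ih'
  · rw [map_smul]; exact Submodule.smul_mem _ _ ih

/-- The bracket `((a, a', m), (b, b', n)) = ((a, b), (a', b'), (m, b) + (a', n))`. For
`a' = (-1)^(d|a|) a` it encodes derivations of degree `d`. -/
def tripleBr (br : A →ₗ[K] A →ₗ[K] A) : (A × A × A) →ₗ[K] (A × A × A) →ₗ[K] (A × A × A) :=
  LinearMap.mk₂ K (fun x y => (br x.1 y.1, br x.2.1 y.2.1, br x.2.2 y.1 + br x.2.1 y.2.2))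
    (fun x x' y => by
      ext <;> simp only [Prod.fst_add, Prod.snd_add, map_add, LinearMap.add_apply]; abel)
    (fun c x y => by
      ext <;> simp only [Prod.smul_fst, Prod.smul_snd, map_smul, LinearMap.smul_apply, smul_add])
    (fun x y y' => by
      ext <;> simp only [Prod.fst_add, Prod.snd_add, map_add]; abel)
    (fun c x y => by
      ext <;> simp only [Prod.smul_fst, Prod.smul_snd, map_smul, smul_add])

/-- The elements `(a, (-1)^(d i) a, m)` with `a` of degree `i` and `m` of degree `i + d`. -/
def tripleDeg (deg : ℤ → Submodule K A) (d i : ℤ) : Submodule K (A × A × A) where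
  carrier := {x | x.1 ∈ deg i ∧ x.2.1 = (d * i).negOnePow • x.1 ∧ x.2.2 ∈ deg (i + d)}
  add_mem' {x y} hx hy := ⟨add_mem hx.1 hy.1, by
    rw [Prod.snd_add, Prod.fst_add, Prod.fst_add, hx.2.1, hy.2.1, smul_add],
    add_mem hx.2.2 hy.2.2⟩
  zero_mem' := ⟨zero_mem _, by simp, zero_mem _⟩
  smul_mem' c x hx := ⟨Submodule.smul_mem _ c hx.1, by
    rw [Prod.smul_snd, Prod.smul_fst, Prod.smul_fst, hx.2.1, smul_comm],
    Submodule.smul_mem _ c hx.2.2⟩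

theorem units_smul_br (s : ℤˣ) (x y : A) : br (s • x) y = s • br x y := by
  rcases Int.units_eq_one_or s with rfl | rfl <;> simp

theorem br_units_smul (s : ℤˣ) (x y : A) : br x (s • y) = s • br x y := by
  rcases Int.units_eq_one_or s with rfl | rfl <;> simp

theorem units_smul_mem {p : Submodule K A} (s : ℤˣ) {x : A} (hx : x ∈ p) : s • x ∈ p := by
  rcases Int.units_eq_one_or s with rfl | rfl <;> simpa

/-- The third component of each identity is a sum of identities of `br` in which one entry has its
degree shifted by `d`; the signed copy in the second slot supplies the Koszul sign of the shift. The
subspaces `tripleDeg` need not span, hence the weaker structure without a direct sum decomposition.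
-/
theorem tripleBr_isGradedBracket (h : IsGradedBracket deg br) (d : ℤ) :
    IsGradedBracket (tripleDeg deg d) (tripleBr br) where
  br_mem {i j x y} := by
    rintro ⟨hx, hx', hx''⟩ ⟨hy, hy', hy''⟩
    refine ⟨h.br_mem hx hy, ?_, ?_⟩
    · simp only [tripleBr, LinearMap.mk₂_apply, hx', hy', units_smul_br, br_units_smul, mul_add,
        Int.negOnePow_add, smul_smul]
      rw [mul_comm]
    · simp only [tripleBr, LinearMap.mk₂_apply, hx', units_smul_br]
      refine add_mem ?_ (units_smul_mem _ ?_)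
      · have := h.br_mem hx'' hy; rwa [add_right_comm] at this
      · have := h.br_mem hx hy''; rwa [← add_assoc] at this
  antisymm {i j x y} := by
    rintro ⟨hx, hx', hx''⟩ ⟨hy, hy', hy''⟩
    simp only [tripleBr, LinearMap.mk₂_apply, hx', hy', units_smul_br, br_units_smul]
    ext
    · exact h.antisymm hx hy
    · simp only [Prod.snd_neg, Prod.fst_neg, Prod.smul_snd, Prod.smul_fst]
      rw [h.antisymm hx hy]
      simp only [smul_neg, smul_smul, mul_comm, mul_left_comm, mul_assoc]
    · simp only [Prod.snd_neg, Prod.smul_snd]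
      rw [h.antisymm hx'' hy, h.antisymm hx hy'']
      simp only [add_mul, mul_add, Int.negOnePow_add, smul_add, smul_neg, smul_smul,
        mul_comm d i, mul_comm d j]
      -- Only one entry is shifted at a time, so no sign involving `d * d` appears and three
      -- independent signs remain.
      rcases Int.units_eq_one_or (i * d).negOnePow with h1 | h1 <;>
      rcases Int.units_eq_one_or (i * j).negOnePow with h2 | h2 <;>
      rcases Int.units_eq_one_or (j * d).negOnePow with h3 | h3 <;>
      simp [h1, h2, h3]
  jacobi {i j k x y z} := by
    rintro ⟨hx, hx', hx''⟩ ⟨hy, hy', hy''⟩ ⟨hz, hz', hz''⟩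
    simp only [tripleBr, LinearMap.mk₂_apply, hx', hy', hz', units_smul_br, br_units_smul,
      map_add, LinearMap.add_apply]
    ext
    · exact h.jacobi hx hy hz
    · simp only [Prod.snd_add, Prod.fst_add, Prod.smul_snd, Prod.smul_fst]
      rw [h.jacobi hx hy hz]
      simp only [smul_add, smul_smul, mul_comm, mul_left_comm, mul_assoc]
    · simp only [Prod.snd_add, Prod.smul_snd]
      rw [h.jacobi hx'' hy hz, h.jacobi hx hy'' hz, h.jacobi hx hy hz'']
      simp only [add_mul, mul_add, Int.negOnePow_add, smul_add, smul_smul, mul_comm d i, mul_comm d j]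
      rcases Int.units_eq_one_or (i * d).negOnePow with h1 | h1 <;>
      rcases Int.units_eq_one_or (i * j).negOnePow with h2 | h2 <;>
      rcases Int.units_eq_one_or (j * d).negOnePow with h3 | h3 <;>
      simp [h1, h2, h3] <;> abel

/-- Derivations of degree `d` along a homomorphism from the free graded Lie algebra exist with
prescribed values on generators. -/
theorem exists_derivation (h : IsGradedBracket deg br) {φ : FreeLie K V →ₗ[K] A}
    (hφ : ∀ α β, φ (freeBr K V α β) = br (φ α) (φ β)) (hφ1 : ∀ x, φ (freeOf K x) ∈ deg (-1))
    (d : ℤ) (f : V →ₗ[K] A) (hf : ∀ x, f x ∈ deg (-1 + d)) :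
    ∃ D : FreeLie K V →ₗ[K] A, (∀ x, D (freeOf K x) = f x) ∧
      (∀ {i : ℤ} {α : FreeLie K V}, α ∈ freeDeg K V i → D α ∈ deg (i + d)) ∧
      ∀ {i : ℤ} {α : FreeLie K V} (β : FreeLie K V), α ∈ freeDeg K V i →
        D (freeBr K V α β) = br (D α) (φ β) + (d * i).negOnePow • br (φ α) (D β) := by
  have hT := tripleBr_isGradedBracket h d
  -- The generators are sent to `(φ x, ± φ x, f x)`, homogeneous of degree -1 for `tripleDeg`. The
  -- derivation sought is the third component of the resulting homomorphism.
  obtain ⟨ψ, hψ, hψbr⟩ := exists_freeLift (V := V) hT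
    ((φ ∘ₗ freeOfₗ K V).prod (((d * -1).negOnePow • φ ∘ₗ freeOfₗ K V).prod f))
    (fun x => ⟨hφ1 x, rfl, hf x⟩)
  have hfst : ∀ α, (ψ α).1 = φ α := by
    intro α
    induction α using freeLie_induction with
    | of x => rw [hψ]; rfl
    | br i j α β _ _ ih ih' => rw [hψbr, hφ, ← ih, ← ih']; rfl
    | zero => simp
    | add α β ih ih' => rw [map_add, map_add, Prod.fst_add, ih, ih']
    | smul c α ih => rw [map_smul, map_smul, Prod.smul_fst, ih]
  have hmem : ∀ {i : ℤ} {α : FreeLie K V}, α ∈ freeDeg K V i → ψ α ∈ tripleDeg deg d i :=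
    freeHom_mem hT hψbr fun x => by rw [hψ]; exact ⟨hφ1 x, rfl, hf x⟩
  refine ⟨LinearMap.snd K A A ∘ₗ LinearMap.snd K A (A × A) ∘ₗ ψ, fun x => ?_, fun hα => ?_,
    fun {i α} β hα => ?_⟩
  · simp only [LinearMap.comp_apply, hψ]; rfl
  · exact (hmem hα).2.2
  -- Membership in `tripleDeg` identifies the second component with `φ α` up to the Koszul sign,
  -- which turns the third component of the bracket into the derivation rule.
  · have h1 := (hmem hα).2.1
    simp only [LinearMap.comp_apply, LinearMap.snd_apply, hψbr]
    simp only [tripleBr, LinearMap.mk₂_apply, h1, hfst, units_smul_br]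

end Lift

/-! ## The action of `𝔤_Lie` on the free graded Lie algebra -/

section Action

variable {K : Type u} [Field K] (g : LeibnizAlg.{u, v} K)

theorem exists_leftDerivation (x : g.carrier) :
    ∃ D : FreeLie K g.carrier →ₗ[K] FreeLie K g.carrier,
      (∀ y, D (freeOf K y) = freeOf K (g.br x y)) ∧
      (∀ {i : ℤ} {α : FreeLie K g.carrier}, α ∈ freeDeg K g.carrier i →
        D α ∈ freeDeg K g.carrier i) ∧
      ∀ α β, D (freeBr K g.carrier α β)
        = freeBr K g.carrier (D α) β + freeBr K g.carrier α (D β) := by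
  obtain ⟨D, h1, h2, h3⟩ := exists_derivation (freeBr_isGradedBracket (K := K) (V := g.carrier))
    (φ := LinearMap.id) (fun _ _ => rfl) freeOf_mem 0 (freeOfₗ K g.carrier ∘ₗ g.br x)
    (fun y => freeOf_mem (g.br x y))
  -- In degree 0 the sign is trivial, so the rule extends by linearity to inhomogeneous `α`.
  refine ⟨D, h1, fun hα => by simpa using h2 hα, fun α β => ?_⟩
  induction α using freeLie_span_induction with
  | mono m => simpa using h3 β (freeMono_mem m)
  | zero => simp
  | add α α' h h' => simp only [map_add, LinearMap.add_apply, h, h']; abel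
  | smul c α h => simp only [map_smul, LinearMap.smul_apply, h, smul_add]

/-- The derivation of the free graded Lie algebra on `𝔤[1]` extending `y ↦ [x, y]`. -/
def leftDerivation (x : g.carrier) : FreeLie K g.carrier →ₗ[K] FreeLie K g.carrier :=
  (exists_leftDerivation g x).choose

variable {g}

theorem leftDerivation_of (x y : g.carrier) :
    leftDerivation g x (freeOf K y) = freeOf K (g.br x y) :=
  (exists_leftDerivation g x).choose_spec.1 y

theorem leftDerivation_mem (x : g.carrier) {i : ℤ} {α : FreeLie K g.carrier}
    (hα : α ∈ freeDeg K g.carrier i) : leftDerivation g x α ∈ freeDeg K g.carrier i :=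
  (exists_leftDerivation g x).choose_spec.2.1 hα

theorem leftDerivation_br (x : g.carrier) (α β : FreeLie K g.carrier) :
    leftDerivation g x (freeBr K g.carrier α β)
      = freeBr K g.carrier (leftDerivation g x α) β
        + freeBr K g.carrier α (leftDerivation g x β) :=
  (exists_leftDerivation g x).choose_spec.2.2 α β

/-- Derivations of degree `0` of the free graded Lie algebra agree if they agree on
generators. -/
theorem derivation_ext {D D' : FreeLie K g.carrier →ₗ[K] FreeLie K g.carrier}
    (h : ∀ α β, D (freeBr K g.carrier α β)
      = freeBr K g.carrier (D α) β + freeBr K g.carrier α (D β))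
    (h' : ∀ α β, D' (freeBr K g.carrier α β)
      = freeBr K g.carrier (D' α) β + freeBr K g.carrier α (D' β))
    (hof : ∀ y, D (freeOf K y) = D' (freeOf K y)) : D = D' := by
  refine LinearMap.ext fun α => ?_
  induction α using freeLie_induction with
  | of x => exact hof x
  | br i j α β _ _ ih ih' => rw [h, h', ih, ih']
  | zero => rw [map_zero, map_zero]
  | add α β ih ih' => rw [map_add, map_add, ih, ih']
  | smul c α ih => rw [map_smul, map_smul, ih]

theorem leftDerivation_add (x y : g.carrier) :
    leftDerivation g (x + y) = leftDerivation g x + leftDerivation g y :=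
  derivation_ext (leftDerivation_br _)
    (fun α β => by
      simp only [LinearMap.add_apply, leftDerivation_br, map_add]; abel)
    (fun z => by simp only [LinearMap.add_apply, leftDerivation_of, map_add, freeOf_add])

theorem leftDerivation_smul (c : K) (x : g.carrier) :
    leftDerivation g (c • x) = c • leftDerivation g x :=
  derivation_ext (leftDerivation_br _)
    (fun α β => by
      simp only [LinearMap.smul_apply, leftDerivation_br, map_smul, smul_add])
    (fun z => by simp only [LinearMap.smul_apply, leftDerivation_of, map_smul, freeOf_smul])

/-- A commutator of derivations is a derivation, and on generators the claim is the Leibniz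
identity. -/
theorem leftDerivation_bracket (x y : g.carrier) (α : FreeLie K g.carrier) :
    leftDerivation g (g.br x y) α = leftDerivation g x (leftDerivation g y α)
      - leftDerivation g y (leftDerivation g x α) := by
  have h : leftDerivation g (g.br x y) = leftDerivation g x ∘ₗ leftDerivation g y
      - leftDerivation g y ∘ₗ leftDerivation g x := by
    refine derivation_ext (leftDerivation_br _) (fun α β => ?_) (fun z => ?_)
    · simp only [LinearMap.sub_apply, LinearMap.comp_apply, leftDerivation_br, map_add, map_sub]
      abel
    · simp only [LinearMap.sub_apply, LinearMap.comp_apply, leftDerivation_of]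
      rw [g.leibniz x y z, freeOf_add, add_sub_cancel_right]
  rw [h]; rfl

variable (g) in
/-- The action of `𝔤` on the free graded Lie algebra on `𝔤[1]`. -/
def leftAction : g.carrier →ₗ[K] FreeLie K g.carrier →ₗ[K] FreeLie K g.carrier where
  toFun := leftDerivation g
  map_add' := leftDerivation_add
  map_smul' := leftDerivation_smul

/-- The operator of `[x,y]` is a commutator and changes sign when `x` and `y` are exchanged. -/
theorem symmIdeal_le_ker_leftAction : symmIdeal g ≤ LinearMap.ker (leftAction g) := by
  refine Submodule.span_le.2 ?_
  rintro _ ⟨x, y, rfl⟩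
  refine LinearMap.ext fun α => ?_
  simp only [map_add, LinearMap.add_apply, leftAction, LinearMap.coe_mk, AddHom.coe_mk,
    leftDerivation_bracket, LinearMap.zero_apply]
  abel

/-- Compare the Leibniz identities for `a, b, c` and `b, a, c`: their remaining terms agree up to
exchange, which forces `[[a,b],c] + [[b,a],c] = 0`. -/
theorem br_symmIdeal_left {z : g.carrier} (hz : z ∈ symmIdeal g) (x : g.carrier) :
    g.br z x = 0 := by
  have h : symmIdeal g ≤ LinearMap.ker g.br := by
    refine Submodule.span_le.2 ?_
    rintro _ ⟨a, b, rfl⟩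
    refine LinearMap.ext fun c => ?_
    have h1 := g.leibniz a b c
    have h2 := g.leibniz b a c
    rw [map_add, LinearMap.add_apply, LinearMap.zero_apply]
    rw [h2, ← add_assoc] at h1
    simpa using h1
  exact LinearMap.congr_fun (h hz) x

/-- Left multiplication is a derivation, so it sends one symmetrized bracket to a sum of two. -/
theorem br_symmIdeal_right {z : g.carrier} (hz : z ∈ symmIdeal g) (x : g.carrier) :
    g.br x z ∈ symmIdeal g := by
  have h : symmIdeal g ≤ (symmIdeal g).comap (g.br x) := by
    refine Submodule.span_le.2 ?_
    rintro _ ⟨a, b, rfl⟩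
    have h1 : g.br x (g.br a b + g.br b a) = (g.br (g.br x a) b + g.br b (g.br x a))
        + (g.br a (g.br x b) + g.br (g.br x b) a) := by
      rw [map_add, g.leibniz x a b, g.leibniz x b a]; abel
    rw [SetLike.mem_coe, Submodule.mem_comap, h1]
    exact add_mem (Submodule.subset_span ⟨_, _, rfl⟩) (Submodule.subset_span ⟨_, _, rfl⟩)
  exact h hz

variable (g) in
/-- The bracket of `𝔤_Lie`. -/
def lieBr : Liezation g →ₗ[K] Liezation g →ₗ[K] Liezation g :=
  LinearMap.liftQ₂ (symmIdeal g) (symmIdeal g) (g.br.compr₂ (symmIdeal g).mkQ)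
    (fun z hz => LinearMap.ext fun x => by
      simp [br_symmIdeal_left hz x])
    (fun z hz => LinearMap.ext fun x => by
      simpa using br_symmIdeal_right hz x)

theorem lieBr_proj (x y : g.carrier) :
    lieBr g (liezationProj g x) (liezationProj g y) = liezationProj g (g.br x y) := rfl

variable (g) in
/-- The action of `𝔤_Lie` on the free graded Lie algebra on `𝔤[1]`. -/
def lieAct : Liezation g →ₗ[K] FreeLie K g.carrier →ₗ[K] FreeLie K g.carrier :=
  (symmIdeal g).liftQ (leftAction g) symmIdeal_le_ker_leftAction

theorem lieAct_proj (x : g.carrier) (α : FreeLie K g.carrier) :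
    lieAct g (liezationProj g x) α = leftDerivation g x α := rfl

theorem lieAct_proj_of (x y : g.carrier) :
    lieAct g (liezationProj g x) (freeOf K y) = freeOf K (g.br x y) :=
  leftDerivation_of x y

theorem liezationProj_surjective : Function.Surjective (liezationProj g) :=
  (symmIdeal g).mkQ_surjective

theorem lieAct_mem (a : Liezation g) {i : ℤ} {α : FreeLie K g.carrier}
    (hα : α ∈ freeDeg K g.carrier i) : lieAct g a α ∈ freeDeg K g.carrier i := by
  obtain ⟨x, rfl⟩ := liezationProj_surjective a
  exact leftDerivation_mem x hα

theorem lieAct_br (a : Liezation g) (α β : FreeLie K g.carrier) :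
    lieAct g a (freeBr K g.carrier α β)
      = freeBr K g.carrier (lieAct g a α) β + freeBr K g.carrier α (lieAct g a β) := by
  obtain ⟨x, rfl⟩ := liezationProj_surjective a
  exact leftDerivation_br x α β

theorem lieAct_lieBr (a b : Liezation g) (α : FreeLie K g.carrier) :
    lieAct g (lieBr g a b) α = lieAct g a (lieAct g b α) - lieAct g b (lieAct g a α) := by
  obtain ⟨x, rfl⟩ := liezationProj_surjective a
  obtain ⟨y, rfl⟩ := liezationProj_surjective b
  exact leftDerivation_bracket x y α

theorem lieBr_antisymm (a b : Liezation g) : lieBr g a b = -lieBr g b a := by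
  obtain ⟨x, rfl⟩ := liezationProj_surjective a
  obtain ⟨y, rfl⟩ := liezationProj_surjective b
  rw [lieBr_proj, lieBr_proj, eq_neg_iff_add_eq_zero, ← map_add]
  exact (Submodule.Quotient.mk_eq_zero _).2 (Submodule.subset_span ⟨x, y, rfl⟩)

theorem lieBr_jacobi (a b c : Liezation g) :
    lieBr g a (lieBr g b c) = lieBr g (lieBr g a b) c + lieBr g b (lieBr g a c) := by
  obtain ⟨x, rfl⟩ := liezationProj_surjective a
  obtain ⟨y, rfl⟩ := liezationProj_surjective b
  obtain ⟨z, rfl⟩ := liezationProj_surjective c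
  simp only [lieBr_proj, ← map_add, g.leibniz x y z]

end Action

/-! ## The graded Lie algebra `𝔤_Lie ⊕ F_Lie 𝔤[1]` -/

section TotalLie

variable {K : Type u} [Field K] {g : LeibnizAlg.{u, v} K}

variable (g) in
/-- The semidirect product bracket on `𝔤_Lie ⊕ F_Lie 𝔤[1]`. -/
def totalBr : Total g →ₗ[K] Total g →ₗ[K] Total g :=
  LinearMap.mk₂ K (fun x y => (lieBr g x.1 y.1,
      lieAct g x.1 y.2 - lieAct g y.1 x.2 + freeBr K g.carrier x.2 y.2))
    (fun x x' y => by
      ext1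
      · simp only [Prod.fst_add, map_add, LinearMap.add_apply]
      · simp only [Prod.fst_add, Prod.snd_add, map_add, LinearMap.add_apply]; abel)
    (fun c x y => by
      ext1
      · simp only [Prod.smul_fst, map_smul, LinearMap.smul_apply]
      · simp only [Prod.smul_fst, Prod.smul_snd, map_smul, LinearMap.smul_apply, smul_add,
          smul_sub])
    (fun x y y' => by
      ext1
      · simp only [Prod.fst_add, map_add]
      · simp only [Prod.fst_add, Prod.snd_add, map_add, LinearMap.add_apply]; abel)
    (fun c x y => by
      ext1
      · simp only [Prod.smul_fst, map_smul]
      · simp only [Prod.smul_fst, Prod.smul_snd, map_smul, LinearMap.smul_apply, smul_add,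
          smul_sub])

theorem totalBr_apply (x y : Total g) : totalBr g x y = (lieBr g x.1 y.1,
    lieAct g x.1 y.2 - lieAct g y.1 x.2 + freeBr K g.carrier x.2 y.2) := rfl

theorem totalBr_lie_lie (a b : Liezation g) :
    totalBr g (a, 0) (b, 0) = (lieBr g a b, 0) := by simp [totalBr_apply]

theorem totalBr_lie_free (a : Liezation g) (β : FreeLie K g.carrier) :
    totalBr g (a, 0) (0, β) = (0, lieAct g a β) := by simp [totalBr_apply]

theorem totalBr_free_lie (α : FreeLie K g.carrier) (b : Liezation g) :
    totalBr g (0, α) (b, 0) = (0, -lieAct g b α) := by simp [totalBr_apply]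

theorem totalBr_free_free (α β : FreeLie K g.carrier) :
    totalBr g (0, α) (0, β) = (0, freeBr K g.carrier α β) := by simp [totalBr_apply]

/-- The two summands share no degree, so a homogeneous element lies in one of them. Identities in
the total space can thus be checked summand by summand. -/
theorem totalDeg_cases {i : ℤ} {x : Total g} (hx : x ∈ totalDeg g i) :
    (i = 0 ∧ ∃ a, x = (a, 0)) ∨ ∃ α ∈ freeDeg K g.carrier i, x = (0, α) := by
  obtain ⟨a, α⟩ := x
  obtain ⟨ha, hα⟩ := Submodule.mem_prod.1 hx
  rcases mem_concentrated.1 ha with rfl | h0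
  · exact Or.inl ⟨rfl, a, by rw [show α = 0 from freeDeg_of_nonneg le_rfl hα]⟩
  · exact Or.inr ⟨α, hα, by rw [show a = 0 from h0]⟩

theorem lie_mem_totalDeg (a : Liezation g) : ((a, 0) : Total g) ∈ totalDeg g 0 :=
  Submodule.mem_prod.2 ⟨mem_concentrated.2 (Or.inl rfl), zero_mem _⟩

theorem free_mem_totalDeg {i : ℤ} {α : FreeLie K g.carrier} (hα : α ∈ freeDeg K g.carrier i) :
    ((0, α) : Total g) ∈ totalDeg g i :=
  Submodule.mem_prod.2 ⟨zero_mem _, hα⟩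

theorem totalDeg_internal : DirectSum.IsInternal (totalDeg g) := by
  refine isInternal_of_projections
    (fun i => (if i = 0 then LinearMap.id else 0 : Liezation g →ₗ[K] Liezation g).prodMap
      (freeProj K g.carrier i)) (fun i x hx => ?_) (fun i j hij x hx => ?_) ?_
  · rcases totalDeg_cases hx with ⟨rfl, a, rfl⟩ | ⟨α, hα, rfl⟩
    · simp
    · simp [freeProj_of_mem hα]
  · rcases totalDeg_cases hx with ⟨rfl, a, rfl⟩ | ⟨α, hα, rfl⟩
    · simp [hij.symm]
    · simp [freeProj_of_mem_ne hij hα]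
  · rw [eq_top_iff]
    rintro ⟨a, α⟩ -
    have h : ((a, α) : Total g) = (a, 0) + (0, α) := by simp
    rw [h]
    refine add_mem (Submodule.mem_iSup_of_mem 0 (lie_mem_totalDeg a)) ?_
    induction α using freeLie_span_induction with
    | mono m => exact Submodule.mem_iSup_of_mem _ (free_mem_totalDeg (freeMono_mem m))
    | zero => exact zero_mem _
    | add α β hα hβ => simpa using add_mem (hα (by simp)) (hβ (by simp))
    | smul c α hα => simpa using Submodule.smul_mem _ c (hα (by simp))

theorem total_isGradedLie : IsGradedLie (totalDeg g) (totalBr g) where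
  internal := totalDeg_internal
  br_mem {i j x y} hx hy := by
    rcases totalDeg_cases hx with ⟨rfl, a, rfl⟩ | ⟨α, hα, rfl⟩ <;>
    rcases totalDeg_cases hy with ⟨rfl, b, rfl⟩ | ⟨β, hβ, rfl⟩
    · rw [totalBr_lie_lie]; exact lie_mem_totalDeg _
    · rw [totalBr_lie_free, zero_add]; exact free_mem_totalDeg (lieAct_mem a hβ)
    · rw [totalBr_free_lie, add_zero]; exact free_mem_totalDeg (neg_mem (lieAct_mem b hα))
    · rw [totalBr_free_free]; exact free_mem_totalDeg (freeBr_mem hα hβ)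
  antisymm {i j x y} hx hy := by
    rcases totalDeg_cases hx with ⟨rfl, a, rfl⟩ | ⟨α, hα, rfl⟩ <;>
    rcases totalDeg_cases hy with ⟨rfl, b, rfl⟩ | ⟨β, hβ, rfl⟩
    · rw [totalBr_lie_lie, totalBr_lie_lie, lieBr_antisymm]; simp
    · rw [totalBr_lie_free, totalBr_free_lie]; simp
    · rw [totalBr_lie_free, totalBr_free_lie]; simp
    · rw [totalBr_free_free, totalBr_free_free, freeBr_isGradedBracket.antisymm hα hβ]
      simp [Units.smul_def]
  jacobi {i j k x y z} hx hy hz := by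
    have hJ := freeBr_isGradedBracket (K := K) (V := g.carrier)
    rcases totalDeg_cases hx with ⟨rfl, a, rfl⟩ | ⟨α, hα, rfl⟩ <;>
    rcases totalDeg_cases hy with ⟨rfl, b, rfl⟩ | ⟨β, hβ, rfl⟩ <;>
    rcases totalDeg_cases hz with ⟨rfl, c, rfl⟩ | ⟨γ, hγ, rfl⟩ <;>
    simp only [totalBr_lie_lie, totalBr_lie_free, totalBr_free_lie, totalBr_free_free, zero_mul,
      mul_zero, Int.negOnePow_zero, one_smul, Prod.mk_add_mk, add_zero, Prod.smul_mk,
      smul_zero, Prod.mk.injEq, true_and, and_true, lieAct_br, lieAct_lieBr, map_neg,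
      LinearMap.neg_apply, smul_neg]
    · exact lieBr_jacobi a b c
    · abel
    · abel
    · abel
    · abel
    -- Here the last entry is in `𝔤_Lie`: the two terms in which `c` acts on `α` cancel by graded
    -- antisymmetry, as the action preserves degrees.
    · rw [hJ.antisymm (lieAct_mem c hα) hβ]; abel
    · exact hJ.jacobi hα hβ hγ

end TotalLie

/-! ## The differential -/

section Differential

variable {K : Type u} [Field K] {g : LeibnizAlg.{u, v} K}

variable (g) in
-- Generators map to `𝔤_Lie`, outside the free algebra, so the differential is built as a derivation
-- of degree 1 along the inclusion into the total space.
theorem exists_freeDifferential :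
    ∃ D : FreeLie K g.carrier →ₗ[K] Total g,
      (∀ x, D (freeOf K x) = (liezationProj g x, 0)) ∧
      (∀ {i : ℤ} {α : FreeLie K g.carrier}, α ∈ freeDeg K g.carrier i →
        D α ∈ totalDeg g (i + 1)) ∧
      ∀ {i : ℤ} {α : FreeLie K g.carrier} (β : FreeLie K g.carrier),
        α ∈ freeDeg K g.carrier i → D (freeBr K g.carrier α β)
          = totalBr g (D α) (0, β) + (1 * i).negOnePow • totalBr g (0, α) (D β) :=
  exists_derivation total_isGradedLie.isGradedBracket
    (φ := LinearMap.inr K (Liezation g) (FreeLie K g.carrier))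
    (fun α β => (totalBr_free_free α β).symm) (fun x => free_mem_totalDeg (freeOf_mem x)) 1
    (LinearMap.inl K (Liezation g) (FreeLie K g.carrier) ∘ₗ liezationProj g)
    (fun x => lie_mem_totalDeg (liezationProj g x))

variable (g) in
/-- The differential on the free graded Lie algebra, with values in the total space. -/
def freeDifferential : FreeLie K g.carrier →ₗ[K] Total g :=
  (exists_freeDifferential g).choose

theorem freeDifferential_of (x : g.carrier) :
    freeDifferential g (freeOf K x) = (liezationProj g x, 0) :=
  (exists_freeDifferential g).choose_spec.1 x

theorem freeDifferential_mem {i : ℤ} {α : FreeLie K g.carrier}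
    (hα : α ∈ freeDeg K g.carrier i) : freeDifferential g α ∈ totalDeg g (i + 1) :=
  (exists_freeDifferential g).choose_spec.2.1 hα

theorem freeDifferential_br {i : ℤ} {α : FreeLie K g.carrier} (β : FreeLie K g.carrier)
    (hα : α ∈ freeDeg K g.carrier i) :
    freeDifferential g (freeBr K g.carrier α β) = totalBr g (freeDifferential g α) (0, β)
      + i.negOnePow • totalBr g (0, α) (freeDifferential g β) := by
  have h := (exists_freeDifferential g).choose_spec.2.2 β hα
  rwa [one_mul] at h

/-- On generators both sides are the class of `[x,y]`; the Jacobi identity with an entry of degree 0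
carries this to brackets. It is the derivation rule for an entry in `𝔤_Lie`, where the differential
vanishes. -/
theorem freeDifferential_lieAct (a : Liezation g) (α : FreeLie K g.carrier) :
    freeDifferential g (lieAct g a α) = totalBr g (a, 0) (freeDifferential g α) := by
  induction α using freeLie_induction with
  | of y =>
    obtain ⟨x, rfl⟩ := liezationProj_surjective a
    rw [lieAct_proj_of, freeDifferential_of, freeDifferential_of, totalBr_lie_lie, lieBr_proj]
  | br i j α β hα hβ ih ih' =>
    have h := (total_isGradedLie (g := g)).isGradedBracket
    rw [lieAct_br, map_add, freeDifferential_br _ (lieAct_mem a hα), freeDifferential_br _ hα,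
      freeDifferential_br _ hα, ih, ih', map_add, br_units_smul,
      h.jacobi (lie_mem_totalDeg a) (freeDifferential_mem hα) (free_mem_totalDeg hβ),
      h.jacobi (lie_mem_totalDeg a) (free_mem_totalDeg hα) (freeDifferential_mem hβ)]
    simp only [zero_mul, Int.negOnePow_zero, one_smul, totalBr_lie_free, smul_add]
    abel
  | zero => simp
  | add α β ih ih' => rw [map_add, map_add, ih, ih', map_add, map_add]
  | smul c α ih => rw [map_smul, map_smul, ih, map_smul, map_smul]

variable (g) in
/-- The differential on the total space. -/
def totalDifferential : Total g →ₗ[K] Total g :=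
  freeDifferential g ∘ₗ LinearMap.snd K (Liezation g) (FreeLie K g.carrier)

theorem totalDifferential_apply (x : Total g) :
    totalDifferential g x = freeDifferential g x.2 := rfl

theorem totalDifferential_br {i : ℤ} {x : Total g} (y : Total g) (hx : x ∈ totalDeg g i) :
    totalDifferential g (totalBr g x y) = totalBr g (totalDifferential g x) y
      + i.negOnePow • totalBr g x (totalDifferential g y) := by
  obtain ⟨b, β⟩ := y
  simp only [totalDifferential_apply]
  rcases totalDeg_cases hx with ⟨rfl, a, rfl⟩ | ⟨α, hα, rfl⟩
  · simp [totalBr_apply (a, 0) (b, β), freeDifferential_lieAct]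
  · have h1 : (((b, β) : Total g)) = (b, 0) + (0, β) := by simp
    -- Moving `b` to the left brings its bracket with the differential of `α` to the form produced
    -- by equivariance; no sign depends on the degree, since `b` has degree 0.
    have h2 := (total_isGradedLie (g := g)).antisymm (freeDifferential_mem hα)
      (lie_mem_totalDeg b)
    rw [mul_zero, Int.negOnePow_zero, one_smul] at h2
    have h3 : totalBr g (0, α) (b, β) = (0, -lieAct g b α + freeBr K g.carrier α β) := by
      simp [totalBr_apply]
    rw [h3, h1, map_add (totalBr g (freeDifferential g α)), h2]
    simp only [map_add, map_neg, freeDifferential_lieAct, freeDifferential_br β hα]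
    abel

/-- The square of an odd derivation is again a derivation, since the mixed terms carry opposite
signs, and on a generator it is the differential of an element of `𝔤_Lie`. -/
theorem totalDifferential_freeDifferential (α : FreeLie K g.carrier) :
    totalDifferential g (freeDifferential g α) = 0 := by
  induction α using freeLie_induction with
  | of y => simp [freeDifferential_of, totalDifferential_apply]
  | br i j α β hα hβ ih ih' =>
    have hsmul : ∀ (s : ℤˣ) (x : Total g),
        totalDifferential g (s • x) = s • totalDifferential g x := fun s x => by
      rcases Int.units_eq_one_or s with rfl | rfl <;> simp
    rw [freeDifferential_br β hα, map_add, hsmul,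
      totalDifferential_br _ (freeDifferential_mem hα),
      totalDifferential_br _ (free_mem_totalDeg hα), ih, ih', Int.negOnePow_succ]
    simp [totalDifferential_apply, Units.smul_def]
  | zero => simp
  | add α β ih ih' => rw [map_add, map_add, ih, ih', add_zero]
  | smul c α ih => rw [map_smul, map_smul, ih, smul_zero]

variable (g) in
/-- The dg Lie algebra `𝒟ℛ 𝔤[1]`. -/
def totalStr : DGLieStr (totalDeg g) where
  br := totalBr g
  d := totalDifferential g
  isDGLie :=
    { total_isGradedLie with
      d_mem := fun {i x} hx => by
        rcases totalDeg_cases hx with ⟨rfl, a, rfl⟩ | ⟨α, hα, rfl⟩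
        · simp [totalDifferential_apply]
        · exact freeDifferential_mem hα
      d_br := totalDifferential_br
      d_d := fun x => totalDifferential_freeDifferential x.2 }

end Differential

/-! ## The differential on right normalized brackets -/

section RightNormed

variable {K : Type u} [Field K] {g : LeibnizAlg.{u, v} K}

theorem rightNormed_succ {V : Type v} [AddCommGroup V] [Module K V] {n : ℕ}
    (x : Fin (n + 2) → V) :
    rightNormed K x = freeBr K V (freeOf K (x 0)) (rightNormed K (Fin.tail x)) := rfl

theorem leftDerivation_rightNormed (a : g.carrier) {n : ℕ} (x : Fin (n + 1) → g.carrier) :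
    leftDerivation g a (rightNormed K x)
      = ∑ j, rightNormed K (Function.update x j (g.br a (x j))) := by
  induction n with
  | zero => simp [rightNormed, leftDerivation_of]
  | succ n ih =>
    rw [rightNormed_succ, leftDerivation_br, leftDerivation_of, ih,
      Fin.sum_univ_succ (n := n + 1), map_sum]
    simp only [rightNormed_succ, Function.update_self, Fin.tail_update_zero,
      Fin.tail_update_succ]
    rfl

theorem boundary_eq {m : ℕ} (x : Fin (m + 2) → g.carrier) :
    boundary g x = (∑ i : Fin (m + 2), ∑ j : Fin (m + 2), if i < j then (-1 : K) ^ (i : ℕ) •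
      rightNormed K (i.removeNth (Function.update x j (g.br (x i) (x j)))) else 0)
    + (-1 : K) ^ m • rightNormed K (Function.update (Fin.init x) (Fin.last m)
        (g.br (x (Fin.last (m + 1))) (x (Fin.last m).castSucc))) := by
  rw [boundary, Finset.sum_filter, Fintype.sum_prod_type]

theorem rightNormed_removeNth_succ {V : Type v} [AddCommGroup V] [Module K V] {m : ℕ}
    (x : Fin (m + 3) → V) (i : Fin (m + 2)) :
    rightNormed K (i.succ.removeNth x)
      = freeBr K V (freeOf K (x 0)) (rightNormed K (i.removeNth (Fin.tail x))) := by
  rw [rightNormed_succ]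
  have h : Fin.tail (i.succ.removeNth x) = i.removeNth (Fin.tail x) := by
    ext k
    simp [Fin.tail, Fin.removeNth]
  rw [h]
  rfl

/-- The terms with `i = 0` are the derivation of `x 0` applied to the tail. All others, including
the exceptional last term, keep `x 0` in front and are those of the tail with one more sign. This
mirrors `∂(x₀, ω) = (x̄₀, ω) - (x₀, ∂ω)`. -/
theorem boundary_succ {m : ℕ} (x : Fin (m + 3) → g.carrier) :
    boundary g x = leftDerivation g (x 0) (rightNormed K (Fin.tail x))
      - freeBr K g.carrier (freeOf K (x 0)) (boundary g (Fin.tail x)) := by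
  have hinit : rightNormed K (Function.update (Fin.init x) (Fin.last (m + 1))
        (g.br (x (Fin.last (m + 2))) (x (Fin.last (m + 1)).castSucc)))
      = freeBr K g.carrier (freeOf K (x 0)) (rightNormed K (Function.update
        (Fin.init (Fin.tail x)) (Fin.last m) (g.br (Fin.tail x (Fin.last (m + 1)))
          (Fin.tail x (Fin.last m).castSucc)))) := by
    rw [rightNormed_succ, ← Fin.succ_last, Fin.tail_update_succ]
    rfl
  rw [boundary_eq, boundary_eq, hinit, leftDerivation_rightNormed, Fin.sum_univ_succ]
  simp only [Fin.sum_univ_succ (n := m + 2), Fin.succ_pos, lt_irrefl, if_true, if_false,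
    Fin.removeNth_zero, Fin.tail_update_succ, Fin.not_lt_zero, zero_add, Fin.succ_lt_succ_iff,
    rightNormed_removeNth_succ, map_add, map_sum, map_smul]
  rw [sub_eq_add_neg, neg_add, add_assoc, ← Finset.sum_neg_distrib]
  simp only [← Finset.sum_neg_distrib]
  refine congrArg₂ _ (by simp [Fin.tail]) (congrArg₂ _ ?_ (by rw [pow_succ]; simp))
  refine Finset.sum_congr rfl fun i _ => Finset.sum_congr rfl fun j _ => ?_
  split_ifs
  · simp [Fin.tail, pow_succ, Function.update_of_ne (Fin.succ_ne_zero j).symm]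
  · simp

theorem freeDifferential_rightNormed {m : ℕ} (x : Fin (m + 2) → g.carrier) :
    freeDifferential g (rightNormed K x) = (0, boundary g x) := by
  induction m with
  | zero =>
    -- For two letters the rule gives `[x₀,x₁] + [x₁,x₀]`, because the last generator also has its
    -- differential in `𝔤_Lie`. This is the source of the exceptional term of the formula.
    rw [rightNormed_succ, freeDifferential_br _ (freeOf_mem _), freeDifferential_of]
    simp [rightNormed, freeDifferential_of, totalBr_lie_free, totalBr_free_lie, lieAct_proj_of,
      boundary_eq]
    simp [Fin.tail]
  | succ m ih =>
    rw [rightNormed_succ, freeDifferential_br _ (freeOf_mem _), freeDifferential_of, ih,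
      boundary_succ, totalBr_lie_free, lieAct_proj, totalBr_free_free]
    simp [sub_eq_add_neg]

end RightNormed

/-! ## The Lie-Leibniz structure on the free graded Lie algebra -/

section LieLeibniz

variable {K : Type u} [Field K] {g : LeibnizAlg.{u, v} K}

variable (g) in
/-- The derived bracket on the free graded Lie algebra. -/
def freeLeibniz :
    FreeLie K g.carrier →ₗ[K] FreeLie K g.carrier →ₗ[K] FreeLie K g.carrier :=
  ((totalBr g ∘ₗ freeDifferential g).compl₂ (LinearMap.inr K (Liezation g) _)).compr₂
    (LinearMap.snd K _ _)

/-- The free summand is an ideal, so projecting the derived bracket to it loses nothing. -/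
theorem totalBr_freeDifferential (α β : FreeLie K g.carrier) :
    totalBr g (freeDifferential g α) (0, β) = (0, freeLeibniz g α β) := by
  ext1
  · simp [totalBr_apply]
  · rfl

theorem freeLeibniz_of (x : g.carrier) (β : FreeLie K g.carrier) :
    freeLeibniz g (freeOf K x) β = leftDerivation g x β := by
  have h := totalBr_freeDifferential (freeOf K x) β
  rw [freeDifferential_of, totalBr_lie_free, lieAct_proj] at h
  exact (Prod.mk.inj h).2.symm

theorem free_inj {α β : FreeLie K g.carrier} (h : ((0, α) : Total g) = (0, β)) : α = β :=
  (Prod.mk.inj h).2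

theorem units_smul_free (s : ℤˣ) (α : FreeLie K g.carrier) :
    s • ((0, α) : Total g) = (0, s • α) := by
  rw [Prod.smul_mk, smul_zero]

theorem add_free (α β : FreeLie K g.carrier) :
    ((0, α) : Total g) + (0, β) = (0, α + β) := by
  rw [Prod.mk_add_mk, add_zero]

/-- Each mixed axiom is inherited from the total algebra: the Leibniz identity from the derived
bracket, `b_br` from the Jacobi identity with first entry `∂α`, and `br_b` from the derivation rule
and antisymmetry. -/
theorem freeLeibniz_isLieLeibniz :
    IsLieLeibniz (freeDeg K g.carrier) (freeBr K g.carrier) (freeLeibniz g) where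
  toIsGradedLie := freeLie_isGradedLie
  b_mem {i j α β} hα hβ := by
    have h := (totalStr g).isOddLeibniz_derived.b_mem (free_mem_totalDeg hα)
      (free_mem_totalDeg hβ)
    have h' : (totalStr g).derived (0, α) (0, β) = (0, freeLeibniz g α β) :=
      totalBr_freeDifferential α β
    rw [h'] at h
    exact (Submodule.mem_prod.1 h).2
  leibniz {i j k α β γ} hα hβ hγ := by
    have h := (totalStr g).isOddLeibniz_derived.leibniz (free_mem_totalDeg hα)
      (free_mem_totalDeg hβ) (free_mem_totalDeg hγ)
    have h' : ∀ α β, (totalStr g).derived (0, α) (0, β) = (0, freeLeibniz g α β) :=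
      totalBr_freeDifferential
    simp only [h', units_smul_free, add_free] at h
    exact free_inj h
  b_br {i j k α β γ} hα hβ hγ := by
    have h := total_isGradedLie.jacobi (freeDifferential_mem hα) (free_mem_totalDeg hβ)
      (free_mem_totalDeg hγ)
    simp only [totalBr_freeDifferential, totalBr_free_free, units_smul_free, add_free] at h
    exact free_inj h
  br_b {i j k α β γ} hα hβ hγ := by
    apply free_inj (g := g)
    -- Exchanging `α` and `∂β` costs the sign of `i * (j + 1)`; the factor from `i` cancels the sign
    -- of the derivation rule and leaves that of `i * j`.
    have h := total_isGradedLie.antisymm (free_mem_totalDeg hα) (freeDifferential_mem hβ)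
    rw [← totalBr_freeDifferential, freeDifferential_br β hα, h, totalBr_freeDifferential,
      totalBr_freeDifferential, smul_neg, smul_smul, mul_add, mul_one,
      Int.negOnePow_add, mul_comm (i * j).negOnePow, ← mul_assoc, Int.units_mul_self, one_mul,
      ← totalBr_free_free]
    congr 2
    simp [sub_eq_add_neg]

/-- A Lie-Leibniz structure on the free graded Lie algebra is determined by its values on
generators. -/
theorem lieLeibniz_unique
    {b b' : FreeLie K g.carrier →ₗ[K] FreeLie K g.carrier →ₗ[K] FreeLie K g.carrier}
    (h : IsLieLeibniz (freeDeg K g.carrier) (freeBr K g.carrier) b)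
    (h' : IsLieLeibniz (freeDeg K g.carrier) (freeBr K g.carrier) b')
    (hof : ∀ x y : g.carrier, b (freeOf K x) (freeOf K y) = b' (freeOf K x) (freeOf K y)) :
    b = b' := by
  refine LinearMap.ext fun α => ?_
  induction α using freeLie_induction with
  | of x =>
    refine LinearMap.ext fun β => ?_
    induction β using freeLie_induction with
    | of y => exact hof x y
    | br i j α β hα hβ ih ih' =>
      rw [h.b_br (freeOf_mem x) hα hβ, h'.b_br (freeOf_mem x) hα hβ, ih, ih']
    | zero => simp
    | add α β ih ih' => rw [map_add, map_add, ih, ih']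
    | smul c α ih => rw [map_smul, map_smul, ih]
  -- The axiom `br_b` involves both `b α β` and `b β α`, so the induction hypotheses are equalities
  -- of operators, not of values at a fixed second argument.
  | br i j α β hα hβ ih ih' =>
    refine LinearMap.ext fun γ => ?_
    induction γ using freeLie_span_induction with
    | mono m =>
      rw [h.br_b hα hβ (freeMono_mem m), h'.br_b hα hβ (freeMono_mem m), ih, ih']
    | zero => simp
    | add α β ih ih' => rw [map_add, map_add, ih, ih']
    | smul c α ih => rw [map_smul, map_smul, ih]
  | zero => simp
  | add α β ih ih' => rw [map_add, map_add, ih, ih']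
  | smul c α ih => rw [map_smul, map_smul, ih]

end LieLeibniz

/-! ## The universal derived bracket representation -/

section Universal

/-- With zero bracket, `V` in degree -1 satisfies the graded Lie identities, so the identity of `V`
extends to a left inverse. -/
theorem freeOf_injective {K : Type u} [Field K] {V : Type v} [AddCommGroup V] [Module K V] :
    Function.Injective (freeOf K : V → FreeLie K V) := by
  have h : IsGradedBracket (concentrated K V (-1)) (0 : V →ₗ[K] V →ₗ[K] V) :=
    ⟨fun _ _ => by simp, fun _ _ => by simp, fun _ _ _ => by simp⟩
  obtain ⟨φ, hφ, -⟩ := exists_freeLift (V := V) h LinearMap.id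
    (fun x => mem_concentrated.2 (Or.inl rfl))
  exact Function.LeftInverse.injective (g := φ) hφ

variable {K : Type u} [Field K] (g : LeibnizAlg.{u, v} K)

/-- The inclusion `𝔤[1] → 𝒟ℛ 𝔤[1]`. -/
def inclusion : OddLeibnizHom (shiftObj g) (derivedObj (totalObj (totalStr g))) where
  toLin := LinearMap.inr K (Liezation g) (FreeLie K g.carrier) ∘ₗ freeOfₗ K g.carrier
  map_deg {i x} hx := by
    rcases mem_concentrated.1 hx with rfl | rfl
    · exact free_mem_totalDeg (freeOf_mem x)
    · rw [map_zero]; exact zero_mem _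
  map_br x y := by
    change ((0, freeOf K (g.br x y)) : Total g)
      = totalBr g (freeDifferential g (freeOf K x)) (0, freeOf K y)
    rw [freeDifferential_of, totalBr_lie_free, lieAct_proj_of]

theorem inclusion_apply (x : g.carrier) :
    (inclusion g).toLin x = ((0, freeOf K x) : Total g) := rfl

variable {g} {h : DGLieAlg.{u, w} K}

theorem map_mem_neg_one (f : OddLeibnizHom (shiftObj g) (derivedObj h)) (x : g.carrier) :
    f.toLin x ∈ h.deg (-1) :=
  f.map_deg (mem_concentrated.2 (Or.inl rfl))

theorem d_map_mem_zero (f : OddLeibnizHom (shiftObj g) (derivedObj h)) (x : g.carrier) :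
    h.str.d (f.toLin x) ∈ h.deg 0 :=
  h.str.isDGLie.d_mem (map_mem_neg_one f x)

/-- Apply `d` to the derived bracket `(d f x, f y)` and use `d² = 0`. Thus `d ∘ f` turns the Leibniz
bracket into an antisymmetric one and factors through `𝔤_Lie`. -/
theorem d_map_br (f : OddLeibnizHom (shiftObj g) (derivedObj h)) (x y : g.carrier) :
    h.str.d (f.toLin (g.br x y)) = h.str.br (h.str.d (f.toLin x)) (h.str.d (f.toLin y)) := by
  have h1 : f.toLin (g.br x y) = h.str.br (h.str.d (f.toLin x)) (f.toLin y) := f.map_br x y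
  rw [h1, h.str.isDGLie.d_br _ (d_map_mem_zero f x), h.str.isDGLie.d_d]
  simp

/-- The map `𝔤_Lie → 𝔥`, `x̄ ↦ d (f x)`, induced by a derived bracket representation. -/
def lieLift (f : OddLeibnizHom (shiftObj g) (derivedObj h)) : Liezation g →ₗ[K] h.carrier :=
  (symmIdeal g).liftQ (h.str.d ∘ₗ f.toLin) <| Submodule.span_le.2 <| by
    rintro _ ⟨x, y, rfl⟩
    have h1 := h.str.isDGLie.antisymm (d_map_mem_zero f x) (d_map_mem_zero f y)
    simp only [mul_zero, Int.negOnePow_zero, one_smul] at h1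
    simp only [SetLike.mem_coe, LinearMap.mem_ker, LinearMap.comp_apply, map_add]
    rw [d_map_br, d_map_br, h1, neg_add_cancel]

theorem lieLift_proj (f : OddLeibnizHom (shiftObj g) (derivedObj h)) (x : g.carrier) :
    lieLift f (liezationProj g x) = h.str.d (f.toLin x) := rfl

/-- The lift is forced: `x̄ ↦ d (f x)` on `𝔤_Lie` and the free extension of `f` on the other
summand. Compatibility with brackets reduces to the action, where on generators it is the hypothesis
on `f`; compatibility with differentials holds on generators by construction and passes to brackets
by the derivation rule. -/
theorem exists_totalLift (f : OddLeibnizHom (shiftObj g) (derivedObj h)) :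
    ∃ ψ : DGLieHom (totalObj (totalStr g)) h, (inclusion g).comp (derivedMap ψ) = f := by
  have hL := h.str.isDGLie.isGradedBracket
  obtain ⟨φ, hφ, hφbr⟩ := exists_freeLift hL f.toLin (map_mem_neg_one f)
  have hφmem : ∀ {i : ℤ} {α : FreeLie K g.carrier}, α ∈ freeDeg K g.carrier i →
      φ α ∈ h.deg i := freeHom_mem hL hφbr fun x => by rw [hφ]; exact map_mem_neg_one f x
  have hmem0 : ∀ a, lieLift f a ∈ h.deg 0 := fun a => by
    obtain ⟨x, rfl⟩ := liezationProj_surjective a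
    exact d_map_mem_zero f x
  have hlie : ∀ a b, lieLift f (lieBr g a b) = h.str.br (lieLift f a) (lieLift f b) :=
    fun a b => by
      obtain ⟨x, rfl⟩ := liezationProj_surjective a
      obtain ⟨y, rfl⟩ := liezationProj_surjective b
      exact d_map_br f x y
  have hact : ∀ a β, φ (lieAct g a β) = h.str.br (lieLift f a) (φ β) := fun a β => by
    obtain ⟨x, rfl⟩ := liezationProj_surjective a
    induction β using freeLie_induction with
    | of y => rw [lieAct_proj_of, hφ, hφ]; exact f.map_br x y
    | br i j α β hα hβ ih ih' =>
      rw [lieAct_br, map_add, hφbr, hφbr, hφbr, ih, ih',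
        hL.jacobi (hmem0 _) (hφmem hα) (hφmem hβ), zero_mul, Int.negOnePow_zero, one_smul]
    | zero => simp
    | add α β ih ih' => simp only [map_add, ih, ih']
    | smul c α ih => simp only [map_smul, ih]
  have hbr : ∀ x y : Total g, (lieLift f).coprod φ (totalBr g x y)
      = h.str.br ((lieLift f).coprod φ x) ((lieLift f).coprod φ y) := by
    rintro ⟨a, α⟩ ⟨b, β⟩
    -- Antisymmetry against an element of degree 0 has no Koszul sign, so it holds for inhomogeneous
    -- `α` too.
    have h1 : h.str.br (φ α) (lieLift f b) = -h.str.br (lieLift f b) (φ α) := by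
      induction α using freeLie_span_induction with
      | mono m =>
        rw [hL.antisymm (hφmem (freeMono_mem m)) (hmem0 b), mul_zero, Int.negOnePow_zero,
          one_smul]
      | zero => simp
      | add α β ih ih' => simp only [map_add, LinearMap.add_apply, ih, ih', neg_add]
      | smul c α ih => simp only [map_smul, LinearMap.smul_apply, ih, smul_neg]
    simp only [totalBr_apply, LinearMap.coprod_apply, map_add, map_sub, hact, hlie, hφbr,
      LinearMap.add_apply, h1]
    abel
  have hd : ∀ α, (lieLift f).coprod φ (freeDifferential g α) = h.str.d (φ α) := fun α => by
    induction α using freeLie_induction with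
    | of x => rw [freeDifferential_of, hφ]; simp [lieLift_proj]
    | br i j α β hα hβ ih ih' =>
      have hsmul : ∀ (s : ℤˣ) (x : Total g),
          (lieLift f).coprod φ (s • x) = s • (lieLift f).coprod φ x := fun s x => by
        rcases Int.units_eq_one_or s with rfl | rfl <;> simp
      rw [freeDifferential_br β hα, map_add, hsmul, hbr, hbr, ih, ih', hφbr,
        h.str.isDGLie.d_br _ (hφmem hα)]
      simp
    | zero => simp
    | add α β ih ih' => simp only [map_add, ih, ih']
    | smul c α ih => simp only [map_smul, ih]
  refine ⟨{ toLin := (lieLift f).coprod φ, map_deg := fun {i x} hx => ?_, map_br := hbr,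
            map_d := fun x => ?_ }, ?_⟩
  · rcases totalDeg_cases hx with ⟨rfl, a, rfl⟩ | ⟨α, hα, rfl⟩
    · simpa using hmem0 a
    · simpa using hφmem hα
  · obtain ⟨a, α⟩ := x
    obtain ⟨x, rfl⟩ := liezationProj_surjective a
    refine (hd α).trans ?_
    simp [lieLift_proj, h.str.isDGLie.d_d]
  · refine OddLeibnizHom.ext (LinearMap.ext fun x => ?_)
    change (lieLift f).coprod φ (0, freeOf K x) = f.toLin x
    simp [hφ]

theorem totalHom_ext {ψ ψ' : DGLieHom (totalObj (totalStr g)) h}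
    (hψ : (inclusion g).comp (derivedMap ψ) = (inclusion g).comp (derivedMap ψ')) : ψ = ψ' := by
  have hof : ∀ x : g.carrier, ψ.toLin ((0, freeOf K x) : Total g)
      = ψ'.toLin ((0, freeOf K x) : Total g) := fun x =>
    LinearMap.congr_fun (congrArg OddLeibnizHom.toLin hψ) x
  have hlie : ∀ a : Liezation g, ψ.toLin ((a, 0) : Total g) = ψ'.toLin ((a, 0) : Total g) :=
    fun a => by
      obtain ⟨x, rfl⟩ := liezationProj_surjective a
      -- Since `x̄ = ∂x`, the values on `𝔤_Lie` are determined by those on generators.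
      have h1 : ((liezationProj g x, 0) : Total g) = (totalStr g).d (0, freeOf K x) :=
        (freeDifferential_of x).symm
      rw [h1]
      exact (ψ.map_d _).trans ((congrArg h.str.d (hof x)).trans (ψ'.map_d _).symm)
  have hfree : ∀ α : FreeLie K g.carrier, ψ.toLin ((0, α) : Total g)
      = ψ'.toLin ((0, α) : Total g) := fun α => by
    induction α using freeLie_induction with
    | of x => exact hof x
    | br i j α β _ _ ih ih' =>
      have h1 : ((0, freeBr K g.carrier α β) : Total g) = (totalStr g).br (0, α) (0, β) :=
        (totalBr_free_free α β).symm
      rw [h1]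
      exact (ψ.map_br _ _).trans
        ((congrArg₂ (fun x y => h.str.br x y) ih ih').trans (ψ'.map_br _ _).symm)
    | zero => exact (map_zero ψ.toLin).trans (map_zero ψ'.toLin).symm
    | add α β ih ih' =>
      rw [← add_free]
      exact (map_add ψ.toLin _ _).trans
        ((congrArg₂ (· + ·) ih ih').trans (map_add ψ'.toLin _ _).symm)
    | smul c α ih =>
      have h1 : ((0, c • α) : Total g) = c • (0, α) := by simp
      rw [h1]
      exact (map_smul ψ.toLin _ _).trans
        ((congrArg (c • ·) ih).trans (map_smul ψ'.toLin _ _).symm)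
  refine DGLieHom.ext (LinearMap.ext fun x => ?_)
  obtain ⟨a, α⟩ := x
  have h1 : ((a, α) : Total g) = (a, 0) + (0, α) := by simp
  rw [h1]
  exact (map_add ψ.toLin _ _).trans
    ((congrArg₂ (· + ·) (hlie a) (hfree α)).trans (map_add ψ'.toLin _ _).symm)

/-- The morphism of dg Lie algebras induced by a derived bracket representation. -/
def totalLift (f : OddLeibnizHom (shiftObj g) (derivedObj h)) :
    DGLieHom (totalObj (totalStr g)) h :=
  (exists_totalLift f).choose

theorem inclusion_comp_totalLift (f : OddLeibnizHom (shiftObj g) (derivedObj h)) :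
    (inclusion g).comp (derivedMap (totalLift f)) = f :=
  (exists_totalLift f).choose_spec

end Universal

/-! ## The functor `𝒟ℛ` -/

section Functoriality

variable {K : Type u} [Field K]

/-- The functor `𝒟ℛ` on morphisms. -/
def totalMap {g g' : LeibnizAlg.{u, max u v} K} (φ : g ⟶ g') :
    (totalObj (totalStr g) : DGLieAlg.{u, max u v} K) ⟶ totalObj (totalStr g') :=
  totalLift (((shift K).map φ : OddLeibnizHom (shiftObj g) (shiftObj g')).comp (inclusion g'))

theorem inclusion_comp_totalMap {g g' : LeibnizAlg.{u, max u v} K} (φ : g ⟶ g') :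
    (inclusion g).comp (derivedMap (totalMap φ))
      = ((shift K).map φ : OddLeibnizHom (shiftObj g) (shiftObj g')).comp (inclusion g') :=
  inclusion_comp_totalLift _

/-- Functoriality comes from uniqueness of lifts: both morphisms have the same composite with the
inclusion. -/
theorem totalMap_id (g : LeibnizAlg.{u, max u v} K) :
    totalMap (𝟙 g) = 𝟙 (totalObj (totalStr g)) :=
  totalHom_ext (inclusion_comp_totalMap (𝟙 g))

theorem totalMap_comp {g g' g'' : LeibnizAlg.{u, max u v} K} (φ : g ⟶ g') (χ : g' ⟶ g'') :
    totalMap (φ ≫ χ) = totalMap φ ≫ totalMap χ := by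
  have h1 := congrArg (fun f => f.comp (derivedMap (totalMap χ))) (inclusion_comp_totalMap φ)
  have h2 := congrArg
    (OddLeibnizHom.comp ((shift K).map φ : OddLeibnizHom (shiftObj g) (shiftObj g')))
    (inclusion_comp_totalMap χ)
  exact totalHom_ext ((inclusion_comp_totalMap (φ ≫ χ)).trans (h1.trans h2).symm)

/-- The bijection `Hom (𝒟ℛ 𝔤[1], 𝔥) ≃ Hom (𝔤[1], 𝒟𝒞 𝔥)`. -/
def totalHomEquiv (g : LeibnizAlg.{u, max u v} K) (h : DGLieAlg.{u, max u v} K) :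
    ((totalObj (totalStr g) : DGLieAlg.{u, max u v} K) ⟶ h)
      ≃ ((shift K).obj g ⟶ (DC K).obj h) where
  toFun ψ := (inclusion g).comp (derivedMap ψ)
  invFun f := totalLift f
  left_inv _ := totalHom_ext (inclusion_comp_totalLift _)
  right_inv f := inclusion_comp_totalLift f

end Functoriality

end DerivedBracket

end

/-! ### Assembly of the universal derived bracket construction -/

theorem mainTheorem1 (K : Type u) [Field K] :
    -- dg Lie algebra structures on all the total spaces
    ∃ S : ∀ g : LeibnizAlg.{u, max u v} K,
        DGLieStr (totalDeg g),
      (∀ g : LeibnizAlg.{u, max u v} K,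
        -- the bracket of `𝔤_Lie`, its action on `𝔤[1]`, and the free Lie bracket
        (∀ x y : g.carrier,
          (S g).br (liezationProj g x, 0) (liezationProj g y, 0)
            = (liezationProj g (g.br x y), 0)) ∧
        (∀ x y : g.carrier,
          (S g).br (liezationProj g x, 0) (0, freeOf K y)
            = (0, freeOf K (g.br x y))) ∧
        (∀ α β : FreeLie K g.carrier,
          (S g).br (0, α) (0, β) = (0, freeBr K g.carrier α β)) ∧
        -- the differential is `∂`, augmented by `𝔤[1] → 𝔤_Lie`
        (∀ a : Liezation g, (S g).d (a, 0) = 0) ∧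
        (∀ x : g.carrier,
          (S g).d (0, freeOf K x) = (liezationProj g x, 0)) ∧
        (∀ (m : ℕ) (x : Fin (m + 2) → g.carrier),
          (S g).d (0, rightNormed K x) = (0, boundary g x)) ∧
        -- `F_Lie 𝔤[1]` is a Lie-Leibniz algebra extending the bracket of `𝔤[1]`,
        -- and its Leibniz bracket is the derived bracket
        (∃ b : FreeLie K g.carrier →ₗ[K] FreeLie K g.carrier →ₗ[K]
            FreeLie K g.carrier,
          IsLieLeibniz (freeDeg K g.carrier)
            (freeBr K g.carrier) b ∧
          ∀ x y : g.carrier, b (freeOf K x) (freeOf K y)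
            = freeOf K (g.br x y)) ∧
        (∀ b : FreeLie K g.carrier →ₗ[K] FreeLie K g.carrier →ₗ[K]
            FreeLie K g.carrier,
          IsLieLeibniz (freeDeg K g.carrier)
            (freeBr K g.carrier) b →
          (∀ x y : g.carrier, b (freeOf K x) (freeOf K y)
            = freeOf K (g.br x y)) →
          ∀ α β : FreeLie K g.carrier,
            (S g).br ((S g).d (0, α)) (0, β) = (0, b α β))) ∧
      -- the inclusion is an injective derived bracket representation
      ∃ ι : ∀ g : LeibnizAlg.{u, max u v} K,
          OddLeibnizHom (shiftObj g)
            (derivedObj (totalObj (S g))),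
        (∀ (g : LeibnizAlg.{u, max u v} K) (x : g.carrier),
          (ι g).toLin x = ((0, freeOf K x) : Total g)) ∧
        (∀ g : LeibnizAlg.{u, max u v} K, Function.Injective (ι g).toLin) ∧
        -- universality
        (∀ (g : LeibnizAlg.{u, max u v} K) (h : DGLieAlg.{u, w} K)
          (f : OddLeibnizHom (shiftObj g)
            (derivedObj h)),
          ∃! ψ : DGLieHom (totalObj (S g)) h,
            (ι g).comp (derivedMap ψ) = f) ∧
        -- the functor `𝒟ℛ` and the natural bijection
        -- `Hom (𝒟ℛ 𝔤[1], 𝔥) ≃ Hom (𝔤[1], 𝒟𝒞 𝔥)` given by composition with `ι`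
        ∃ (map : ∀ {g g' : LeibnizAlg.{u, max u v} K}, (g ⟶ g') →
              ((totalObj (S g) : DGLieAlg.{u, max u v} K) ⟶ totalObj (S g')))
          (map_id : ∀ g : LeibnizAlg.{u, max u v} K, map (𝟙 g) = 𝟙 (totalObj (S g)))
          (map_comp : ∀ {g g' g'' : LeibnizAlg.{u, max u v} K} (φ : g ⟶ g') (χ : g' ⟶ g''),
            map (φ ≫ χ) = map φ ≫ map χ),
          let DR : LeibnizAlg.{u, max u v} K ⥤ DGLieAlg.{u, max u v} K :=
            { obj := fun g => totalObj (S g), map := map, map_id := map_id,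
              map_comp := map_comp }
          ∃ e : ∀ (g : LeibnizAlg.{u, max u v} K) (h : DGLieAlg.{u, max u v} K),
              (DR.obj g ⟶ h) ≃ ((shift K).obj g ⟶ (DC K).obj h),
            (∀ (g : LeibnizAlg.{u, max u v} K) (h : DGLieAlg.{u, max u v} K)
              (ψ : DR.obj g ⟶ h), e g h ψ = ι g ≫ (DC K).map ψ) ∧
            (∀ (g g' : LeibnizAlg.{u, max u v} K) (h h' : DGLieAlg.{u, max u v} K)
              (φ : g' ⟶ g) (ψ : DR.obj g ⟶ h) (χ : h ⟶ h'),
              e g' h' (DR.map φ ≫ ψ ≫ χ) = (shift K).map φ ≫ e g h ψ ≫ (DC K).map χ) := by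
  refine ⟨totalStr, fun g => ⟨fun x y => totalBr_lie_lie _ _, fun x y => ?_,
    totalBr_free_free, fun _ => map_zero (freeDifferential g), freeDifferential_of,
    fun m x => freeDifferential_rightNormed x,
    ⟨freeLeibniz g, freeLeibniz_isLieLeibniz, fun x y => ?_⟩, fun b hb hof α β => ?_⟩,
    inclusion, inclusion_apply, fun g x y hxy => freeOf_injective (Prod.mk.inj hxy).2,
    fun g h f => ⟨totalLift f, inclusion_comp_totalLift f,
      fun ψ hψ => totalHom_ext (hψ.trans (inclusion_comp_totalLift f).symm)⟩,
    totalMap, totalMap_id, totalMap_comp, totalHomEquiv, fun _ _ _ => rfl,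
    fun g g' h h' φ ψ χ => ?_⟩
  · exact (totalBr_lie_free _ _).trans (congrArg _ (lieAct_proj_of x y))
  · rw [freeLeibniz_of, leftDerivation_of]
  -- Any admissible `b` agrees with `freeLeibniz` on generators, hence everywhere.
  · rw [lieLeibniz_unique hb freeLeibniz_isLieLeibniz fun x y => by
      rw [hof, freeLeibniz_of, leftDerivation_of]]
    exact totalBr_freeDifferential α β
  -- The bijection is composition with the inclusion, so naturality is naturality of the inclusion
  -- followed by composition with `ψ ≫ χ`; associativity is definitional.
  · exact congrArg (fun f => OddLeibnizHom.comp f (derivedMap (ψ ≫ χ)))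
      (inclusion_comp_totalMap φ)
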